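/- Let $A$ be a unital $C^*$-algebra and let $u,v\in A$ be unitaries such that $\|uv-vu\|<2$ and such that $uvu^*v^*$ commutes with $u$ and with $v$. Let $A_{u,v}$ be the $C^*$-subalgebra of $A$ generated by $u$ and $v$. For $\theta\in\mathbb{R}$ let $A_\theta$ denote the rotation algebra, i.e. the universal unital $C^*$-algebra generated by two unitaries $u_\theta,v_\theta$ subject to the relation $u_\theta v_\theta=e^{2\pi i\theta}v_\theta u_\theta$. If $A_{u,v}$ has exactly one tracial state (a positive linear functional $\tau$ with $\tau(1)=1$ and $\tau(ab)=\tau(ba)$ for all $a,b$), then either $A_{u,v}$ is $*$-isomorphic to $A_\theta$ for some irrational number $\theta$, or $A_{u,v}$ is $*$-isomorphic to the matrix algebra $M_n(\mathbb{C})$ for some integer $n\ge 1$. -/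

import Mathlib

open scoped ComplexOrder

noncomputable section

/-- The C⋆-subalgebra of `A` generated by `u` and `v` (together with the unit of `A`, which for
unitary `u` lies in the C⋆-algebra generated by `u` anyway). -/
def generatedCStar {A : Type*} [CStarAlgebra A] (u v : A) : StarSubalgebra ℂ A :=
  (StarAlgebra.adjoin ℂ {u, v}).topologicalClosure

/-- A tracial state: a positive linear functional `τ` with `τ 1 = 1` and `τ (a b) = τ (b a)`. -/
structure IsTracialState {B : Type*} [Ring B] [StarRing B] [Algebra ℂ B] (τ : B →ₗ[ℂ] ℂ) :
    Prop where
  nonneg : ∀ a : B, 0 ≤ τ (star a * a)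
  map_one : τ 1 = 1
  map_mul_comm : ∀ a b : B, τ (a * b) = τ (b * a)

/-- The free unital ⋆-algebra on two unitaries, that is, the complex group algebra of the free
group on two generators. The parameter `θ` only serves to carry the seminorm defined below. -/
def FreeUnitaryPair (_θ : ℝ) : Type := MonoidAlgebra ℂ (FreeGroup (Fin 2))

namespace FreeUnitaryPair

variable {θ : ℝ}

instance : Ring (FreeUnitaryPair θ) := inferInstanceAs (Ring (MonoidAlgebra ℂ (FreeGroup (Fin 2))))

instance : Algebra ℂ (FreeUnitaryPair θ) :=
  inferInstanceAs (Algebra ℂ (MonoidAlgebra ℂ (FreeGroup (Fin 2))))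

/-- The scalar multiple `c g` of a group element `g`. -/
def single (θ : ℝ) (g : FreeGroup (Fin 2)) (c : ℂ) : FreeUnitaryPair θ := MonoidAlgebra.single g c

/-- The first generating unitary. -/
def genU (θ : ℝ) : FreeUnitaryPair θ := single θ (FreeGroup.of 0) 1

/-- The second generating unitary. -/
def genV (θ : ℝ) : FreeUnitaryPair θ := single θ (FreeGroup.of 1) 1

lemma single_mul_single (g h : FreeGroup (Fin 2)) (c d : ℂ) :
    single θ g c * single θ h d = single θ (g * h) (c * d) :=
  MonoidAlgebra.single_mul_single ..

lemma one_def : (1 : FreeUnitaryPair θ) = single θ 1 1 := rfl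

lemma smul_single (a : ℂ) (g : FreeGroup (Fin 2)) (c : ℂ) :
    a • single θ g c = single θ g (a * c) :=
  MonoidAlgebra.smul_single ..

@[elab_as_elim]
lemma induction_single {P : FreeUnitaryPair θ → Prop} (x : FreeUnitaryPair θ) (h0 : P 0)
    (hs : ∀ g c, P (single θ g c)) (ha : ∀ x y, P x → P y → P (x + y)) : P x :=
  MonoidAlgebra.induction_linear x h0 ha hs

/-- The conjugate-linear involution with `g ↦ g⁻¹` on group elements. -/
def starHomAux : MonoidAlgebra ℂ (FreeGroup (Fin 2)) →+ MonoidAlgebra ℂ (FreeGroup (Fin 2)) where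
  toFun x := MonoidAlgebra.mapDomain (fun g => g⁻¹)
    (MonoidAlgebra.map ((starRingEnd ℂ : ℂ →+* ℂ) : ℂ →+ ℂ) x)
  map_zero' := by simp
  map_add' x y := by rw [MonoidAlgebra.map_add, MonoidAlgebra.mapDomain_add]

lemma starHomAux_single (g : FreeGroup (Fin 2)) (c : ℂ) :
    starHomAux (MonoidAlgebra.single g c) = MonoidAlgebra.single g⁻¹ (star c) := by
  simp [starHomAux]

/-- The same involution on `FreeUnitaryPair θ`. -/
def starHom : FreeUnitaryPair θ →+ FreeUnitaryPair θ := starHomAux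

lemma starHom_single (g : FreeGroup (Fin 2)) (c : ℂ) :
    starHom (single θ g c) = single θ g⁻¹ (star c) := starHomAux_single g c

instance : StarRing (FreeUnitaryPair θ) where
  star := starHom
  star_add := map_add starHom
  star_involutive x := by
    show starHom (starHom x) = x
    refine induction_single x ?_ ?_ ?_
    · simp
    · intro g c
      simp [starHom_single]
    · intro x y hx hy
      rw [map_add, map_add, hx, hy]
  star_mul x y := by
    show starHom (x * y) = starHom y * starHom x
    refine induction_single x ?_ ?_ ?_
    · simp
    · intro g c
      refine induction_single y ?_ ?_ ?_
      · simp
      · intro h d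
        simp [single_mul_single, starHom_single, mul_comm]
      · intro y z hy hz
        rw [mul_add, map_add, map_add, hy, hz, add_mul]
    · intro x z hx hz
      rw [add_mul, map_add, map_add, hx, hz, mul_add]

lemma star_single (g : FreeGroup (Fin 2)) (c : ℂ) :
    star (single θ g c) = single θ g⁻¹ (star c) := starHom_single g c

instance : StarModule ℂ (FreeUnitaryPair θ) where
  star_smul a x := by
    refine induction_single x ?_ ?_ ?_
    · simp
    · intro g c
      simp [smul_single, star_single]
    · intro x y hx hy
      rw [smul_add, star_add, hx, hy, star_add, smul_add]

/-- The C⋆-seminorms `p` on the free ⋆-algebra on two unitaries `U`, `V` in which the relation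
`U V = e^{2πiθ} V U` holds. These are precisely the functions `x ↦ ‖φ x‖` for the unital
⋆-homomorphisms `φ` to unital C⋆-algebras such that `φ U φ V = e^{2πiθ} φ V φ U`. -/
structure IsRotationSeminorm (p : Seminorm ℂ (FreeUnitaryPair θ)) : Prop where
  mul_le : ∀ x y, p (x * y) ≤ p x * p y
  star_mul_self : ∀ x, p (star x * x) = p x ^ 2
  relation : p (genU θ * genV θ -
    Complex.exp (2 * Real.pi * Complex.I * θ) • (genV θ * genU θ)) = 0

lemma IsRotationSeminorm.star_eq {p : Seminorm ℂ (FreeUnitaryPair θ)} (hp : IsRotationSeminorm p)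
    (x : FreeUnitaryPair θ) : p (star x) = p x := by
  have key : ∀ y, p y ≤ p (star y) := fun y => by
    by_contra! h
    have h1 := hp.star_mul_self y
    have h2 := hp.mul_le (star y) y
    nlinarith [apply_nonneg p (star y), apply_nonneg p y]
  exact le_antisymm (by simpa using key (star x)) (key x)

lemma exists_bound (x : FreeUnitaryPair θ) :
    ∃ C : ℝ, ∀ p : Seminorm ℂ (FreeUnitaryPair θ), IsRotationSeminorm p → p x ≤ C := by
  refine induction_single x ?_ ?_ ?_
  · exact ⟨0, fun p _ => by simp⟩
  · intro g c
    refine ⟨‖c‖, fun p hp => ?_⟩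
    have e : single θ g c = c • single θ g 1 := by simp [smul_single]
    have h1 : p 1 ≤ 1 := by
      have h := hp.star_mul_self 1
      simp only [star_one, one_mul] at h
      nlinarith [apply_nonneg p (1 : FreeUnitaryPair θ)]
    have h2 := hp.star_mul_self (single θ g 1)
    rw [star_single, single_mul_single] at h2
    simp only [inv_mul_cancel, star_one, one_mul, ← one_def] at h2
    have h3 : p (single θ g 1) ≤ 1 := by
      nlinarith [apply_nonneg p (single θ g 1)]
    rw [e, map_smul_eq_mul]
    nlinarith [norm_nonneg c]
  · rintro x y ⟨C, hC⟩ ⟨D, hD⟩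
    exact ⟨C + D, fun p hp => (map_add_le_add p x y).trans (add_le_add (hC p hp) (hD p hp))⟩

/-- The universal C⋆-seminorm: the supremum of all C⋆-seminorms satisfying the relation. -/
def univNorm (x : FreeUnitaryPair θ) : ℝ :=
  ⨆ p : {p : Seminorm ℂ (FreeUnitaryPair θ) // IsRotationSeminorm p}, p.1 x

lemma isRotationSeminorm_zero : IsRotationSeminorm (0 : Seminorm ℂ (FreeUnitaryPair θ)) :=
  ⟨by simp, by simp, by simp⟩

instance : Nonempty {p : Seminorm ℂ (FreeUnitaryPair θ) // IsRotationSeminorm p} :=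
  ⟨⟨0, isRotationSeminorm_zero⟩⟩

lemma le_univNorm {p : Seminorm ℂ (FreeUnitaryPair θ)} (hp : IsRotationSeminorm p)
    (x : FreeUnitaryPair θ) : p x ≤ univNorm x := by
  obtain ⟨C, hC⟩ := exists_bound x
  exact le_ciSup (f := fun p : {p : Seminorm ℂ (FreeUnitaryPair θ) // IsRotationSeminorm p} =>
    p.1 x) ⟨C, by rintro _ ⟨q, rfl⟩; exact hC q.1 q.2⟩ ⟨p, hp⟩

lemma univNorm_le {x : FreeUnitaryPair θ} {C : ℝ}
    (h : ∀ p : Seminorm ℂ (FreeUnitaryPair θ), IsRotationSeminorm p → p x ≤ C) :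
    univNorm x ≤ C :=
  ciSup_le fun p => h p.1 p.2

lemma univNorm_nonneg (x : FreeUnitaryPair θ) : 0 ≤ univNorm x :=
  (apply_nonneg _ x).trans (le_univNorm isRotationSeminorm_zero x)

instance : Norm (FreeUnitaryPair θ) := ⟨univNorm⟩

instance : SeminormedRing (FreeUnitaryPair θ) :=
  { SeminormedAddCommGroup.ofCore (𝕜 := ℂ) (E := FreeUnitaryPair θ)
      { norm_nonneg := univNorm_nonneg
        norm_smul := fun c x => by
          have h : ∀ (c : ℂ) (x : FreeUnitaryPair θ), univNorm (c • x) ≤ ‖c‖ * univNorm x :=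
            fun c x => univNorm_le fun p hp => by
              rw [map_smul_eq_mul]
              exact mul_le_mul_of_nonneg_left (le_univNorm hp x) (norm_nonneg c)
          refine le_antisymm (h c x) ?_
          by_cases hc : c = 0
          · subst hc
            rw [norm_zero, zero_mul]
            exact univNorm_nonneg _
          · have h2 := h c⁻¹ (c • x)
            rw [inv_smul_smul₀ hc, norm_inv, inv_mul_eq_div, le_div_iff₀ (norm_pos_iff.2 hc)] at h2
            rw [mul_comm]
            exact h2
        norm_triangle := fun x y => univNorm_le fun p hp =>
          (map_add_le_add p x y).trans (add_le_add (le_univNorm hp x) (le_univNorm hp y)) },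
    (inferInstance : Ring (FreeUnitaryPair θ)) with
    norm_mul_le := fun x y => univNorm_le fun p hp => (hp.mul_le x y).trans
      (mul_le_mul (le_univNorm hp x) (le_univNorm hp y) (apply_nonneg _ _) (univNorm_nonneg _)) }

lemma norm_def (x : FreeUnitaryPair θ) : ‖x‖ = univNorm x := rfl

lemma norm_star_eq (x : FreeUnitaryPair θ) : ‖star x‖ = ‖x‖ := by
  have h : ∀ y : FreeUnitaryPair θ, ‖star y‖ ≤ ‖y‖ := fun y => univNorm_le fun p hp => by
    rw [hp.star_eq]
    exact le_univNorm hp y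
  exact le_antisymm (h x) (by simpa using h (star x))

lemma norm_mul_self_le (x : FreeUnitaryPair θ) : ‖x‖ * ‖x‖ ≤ ‖star x * x‖ := by
  rw [← sq, ← Real.le_sqrt (norm_nonneg _) (norm_nonneg _)]
  refine univNorm_le fun p hp => Real.le_sqrt_of_sq_le ?_
  rw [← hp.star_mul_self]
  exact le_univNorm hp _

instance : NormedAlgebra ℂ (FreeUnitaryPair θ) where
  norm_smul_le c x := univNorm_le fun p hp => by
    rw [map_smul_eq_mul]
    exact mul_le_mul_of_nonneg_left (le_univNorm hp x) (norm_nonneg c)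

instance : NormedStarGroup (FreeUnitaryPair θ) where
  norm_star_le x := (norm_star_eq x).le

end FreeUnitaryPair

/-- The rotation algebra `A_θ`: the universal C⋆-algebra generated by two unitaries `U`, `V`
subject to `U V = e^{2πiθ} V U`, that is, the Hausdorff completion of the free ⋆-algebra on two
unitaries with respect to the universal C⋆-seminorm. -/
def RotationAlgebra (θ : ℝ) : Type := UniformSpace.Completion (FreeUnitaryPair θ)

namespace RotationAlgebra

open UniformSpace

variable {θ : ℝ}

instance : NormedRing (RotationAlgebra θ) :=
  inferInstanceAs (NormedRing (Completion (FreeUnitaryPair θ)))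

instance : CompleteSpace (RotationAlgebra θ) :=
  inferInstanceAs (CompleteSpace (Completion (FreeUnitaryPair θ)))

instance : Algebra ℂ (RotationAlgebra θ) :=
  inferInstanceAs (Algebra ℂ (Completion (FreeUnitaryPair θ)))

instance : NormedAlgebra ℂ (RotationAlgebra θ) where
  norm_smul_le c x := norm_smul_le (β := Completion (FreeUnitaryPair θ)) c x

/-- The canonical map from the free ⋆-algebra on two unitaries. -/
def mk (x : FreeUnitaryPair θ) : RotationAlgebra θ := (x : Completion (FreeUnitaryPair θ))

lemma continuous_mk : Continuous (mk : FreeUnitaryPair θ → RotationAlgebra θ) :=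
  Completion.continuous_coe _

lemma denseRange_mk : DenseRange (mk : FreeUnitaryPair θ → RotationAlgebra θ) :=
  Completion.denseRange_coe

lemma mk_add (x y : FreeUnitaryPair θ) : mk (x + y) = mk x + mk y := Completion.coe_add x y

lemma mk_mul (x y : FreeUnitaryPair θ) : mk (x * y) = mk x * mk y := Completion.coe_mul x y

lemma mk_smul (c : ℂ) (x : FreeUnitaryPair θ) : mk (c • x) = c • mk x := Completion.coe_smul c x

lemma norm_mk (x : FreeUnitaryPair θ) : ‖mk x‖ = ‖x‖ := Completion.norm_coe x

/-- The involution, extended by continuity. -/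
instance : Star (RotationAlgebra θ) :=
  ⟨Completion.map (star : FreeUnitaryPair θ → FreeUnitaryPair θ)⟩

lemma uniformContinuous_star_pre :
    UniformContinuous (star : FreeUnitaryPair θ → FreeUnitaryPair θ) :=
  uniformContinuous_addMonoidHom_of_continuous (f := (starAddEquiv : FreeUnitaryPair θ ≃+ _))
    continuous_star

lemma continuous_star' : Continuous (star : RotationAlgebra θ → RotationAlgebra θ) :=
  Completion.continuous_map

lemma mk_star (x : FreeUnitaryPair θ) : mk (star x) = star (mk x) :=
  (Completion.map_coe uniformContinuous_star_pre x).symm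

instance : StarRing (RotationAlgebra θ) where
  star_involutive x := by
    refine denseRange_mk.induction_on x
      (isClosed_eq (continuous_star'.comp continuous_star') continuous_id) fun a => ?_
    rw [← mk_star, ← mk_star, star_star]
  star_mul x y := by
    refine denseRange_mk.induction_on₂ (p := fun x y => star (x * y) = star y * star x)
      (isClosed_eq (continuous_star'.comp continuous_mul)
      ((continuous_star'.comp continuous_snd).mul (continuous_star'.comp continuous_fst)))
      (fun a b => ?_) x y
    rw [← mk_mul, ← mk_star, star_mul, mk_mul, mk_star, mk_star]
  star_add x y := by
    refine denseRange_mk.induction_on₂ (p := fun x y => star (x + y) = star x + star y)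
      (isClosed_eq (continuous_star'.comp continuous_add)
      ((continuous_star'.comp continuous_fst).add (continuous_star'.comp continuous_snd)))
      (fun a b => ?_) x y
    rw [← mk_add, ← mk_star, star_add, mk_add, mk_star, mk_star]

/-- `A_θ` is a unital C⋆-algebra. -/
instance : CStarAlgebra (RotationAlgebra θ) where
  norm_mul_self_le x := by
    refine denseRange_mk.induction_on x
      (isClosed_le (continuous_norm.mul continuous_norm)
        (continuous_norm.comp (continuous_star'.mul continuous_id))) fun a => ?_
    show ‖mk a‖ * ‖mk a‖ ≤ ‖star (mk a) * mk a‖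
    rw [← mk_star, ← mk_mul, norm_mk, norm_mk]
    exact FreeUnitaryPair.norm_mul_self_le a
  star_smul c x := by
    refine denseRange_mk.induction_on x
      (isClosed_eq (continuous_star'.comp (continuous_const_smul c))
        (continuous_star'.const_smul (star c))) fun a => ?_
    rw [← mk_smul, ← mk_star, star_smul, mk_smul, mk_star]

end RotationAlgebra

end

noncomputable section

/-! ### States, traces and averaging of functionals -/

section States

variable {B : Type*} [CStarAlgebra B]

/-! Write B for the algebra generated by u and v, and w for uvu⋆v⋆, which is central in B.
Uniqueness of the trace makes central unitaries scalar. Given μ in the spectrum of a central c,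
Hahn–Banach yields a contractive unital functional with value μ at c. Averaging it over conjugation
by u and then by v keeps this value and produces a trace; the two conjugations commute because w is
central. With a single trace available, the spectrum of c is one point
(`exists_isTracialState_eq_of_mem_spectrum`, `eq_algebraMap_of_unique_trace`). In particular w = ω,
so uv = ωvu with |ω| = 1.

If ω has finite order n, then u^n and v^n are central, hence scalar. After rescaling, u and v have
order n, and spectral projections of u moved around by v are matrix units; they span B, and M_n(ℂ)
is simple (`nonempty_starAlgEquiv_matrix`).

If ω is not a root of unity, then ω = e^{2πiθ} with θ irrational, and the universal property gives a
surjection π from A_θ onto B. Its injectivity does not go through simplicity of A_θ. A trace on B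
makes the monomials u^j v^k orthonormal, so ‖x‖ ≤ (2D+1)‖π x‖ for Laurent polynomials x of degree D.
Applying this to high powers of x⋆x removes the polynomial factor, and π is isometric on a dense
set, hence everywhere (`norm_le_norm_map_of_mem_laurentSpan`). -/

/-- A contractive unital linear functional on a C⋆-algebra is positive. -/
lemma nonneg_of_contractive_of_map_one (φ : B →ₗ[ℂ] ℂ) (hφ : ∀ x, ‖φ x‖ ≤ ‖x‖) (h1 : φ 1 = 1)
    (a : B) : 0 ≤ φ (star a * a) := by
  let := CStarAlgebra.spectralOrder B
  have := CStarAlgebra.spectralOrderedRing B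
  set h := star a * a
  have hsa : IsSelfAdjoint h := IsSelfAdjoint.star_mul_self a
  have h0 : 0 ≤ h := star_mul_self_nonneg a
  have hsc : ∀ c : ℂ, φ (algebraMap ℂ B c) = c := fun c => by
    rw [Algebra.algebraMap_eq_smul_one, map_smul, h1, smul_eq_mul, mul_one]
  -- Perturbing h by it costs only t² in the squared norm, whereas |φ(h) + it|² contains the cross
  -- term 2t Im φ(h), which is linear in t.
  have key : ∀ t : ℝ, (φ h).re ^ 2 + ((φ h).im + t) ^ 2 ≤ ‖h‖ ^ 2 + t ^ 2 := fun t => by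
    have e1 := hφ (h + algebraMap ℂ B (t * Complex.I))
    have e2 : ‖h + algebraMap ℂ B (t * Complex.I)‖ ^ 2 ≤ ‖h‖ ^ 2 + t ^ 2 := by
      rw [sq, ← CStarRing.norm_star_mul_self]
      have : star (h + algebraMap ℂ B (t * Complex.I)) * (h + algebraMap ℂ B (t * Complex.I))
          = h * h + algebraMap ℂ B (t ^ 2) := by
        rw [star_add, hsa.star_eq, ← algebraMap_star_comm, add_mul, mul_add, mul_add,
          ← map_mul]
        have : star (t * Complex.I : ℂ) = -(t * Complex.I) := by simp
        rw [this, map_neg, neg_mul, Algebra.commutes (t * Complex.I : ℂ) h]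
        have : -(t * Complex.I) * (t * Complex.I) = (t : ℂ) ^ 2 := by
          linear_combination (-(t : ℂ) ^ 2) * Complex.I_sq
        rw [this]
        abel
      rw [this]
      refine (norm_add_le _ _).trans (add_le_add ((norm_mul_le _ _).trans_eq (sq _).symm) ?_)
      rcases subsingleton_or_nontrivial B with _ | _
      · rw [Subsingleton.elim (algebraMap ℂ B _) 0, norm_zero]; positivity
      · rw [norm_algebraMap']
        simp
    have e3 : ‖φ (h + algebraMap ℂ B (t * Complex.I))‖ ^ 2
        = (φ h).re ^ 2 + ((φ h).im + t) ^ 2 := by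
      rw [map_add, hsc, ← Complex.normSq_eq_norm_sq, Complex.normSq_apply]
      simp [sq]
    rw [← e3]
    exact (pow_le_pow_left₀ (norm_nonneg _) e1 2).trans e2
  have him : (φ h).im = 0 := by
    by_contra hne
    -- This t makes the cross term equal to ‖h‖² + 1, too large for the bound.
    have := key ((‖h‖ ^ 2 + 1) / (2 * (φ h).im))
    have e : 2 * (φ h).im * ((‖h‖ ^ 2 + 1) / (2 * (φ h).im)) = ‖h‖ ^ 2 + 1 := by
      field_simp
    nlinarith [sq_nonneg (φ h).re, sq_nonneg (φ h).im]
  have hre : 0 ≤ (φ h).re := by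
    -- Since 0 ≤ h ≤ ‖h‖, the value φ(h) lies in the disc of radius ‖h‖ about ‖h‖, hence has
    -- nonnegative real part.
    have e1 : ‖algebraMap ℝ B ‖h‖ - h‖ ≤ ‖h‖ := by
      rw [CStarAlgebra.norm_le_iff_le_algebraMap _ (norm_nonneg _)
        (sub_nonneg.2 hsa.le_algebraMap_norm_self)]
      exact sub_le_self _ h0
    have e2 := (hφ (algebraMap ℝ B ‖h‖ - h)).trans e1
    have e3 : φ (algebraMap ℝ B ‖h‖) = (‖h‖ : ℂ) := by
      rw [IsScalarTower.algebraMap_apply ℝ ℂ B, hsc]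
      rfl
    rw [map_sub, e3] at e2
    have := (Complex.re_le_norm _).trans e2
    simp at this
    exact this
  rw [Complex.le_def]
  exact ⟨hre, him.symm⟩

/-- A positive unital functional satisfies `τ (y⋆ y) ≤ ‖y‖²`. -/
lemma IsTracialState.re_star_mul_self_le {τ : B →ₗ[ℂ] ℂ} (hτ : IsTracialState τ) (y : B) :
    (τ (star y * y)).re ≤ ‖y‖ ^ 2 := by
  let := CStarAlgebra.spectralOrder B
  have := CStarAlgebra.spectralOrderedRing B
  have h := sub_nonneg.2 (CStarAlgebra.star_mul_le_algebraMap_norm_sq (a := y))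
  obtain ⟨c, hc⟩ := CStarAlgebra.nonneg_iff_eq_star_mul_self.1 h
  have e3 : τ (algebraMap ℝ B (‖y‖ ^ 2)) = ((‖y‖ ^ 2 : ℝ) : ℂ) := by
    rw [IsScalarTower.algebraMap_apply ℝ ℂ B, Algebra.algebraMap_eq_smul_one, map_smul,
      hτ.map_one, smul_eq_mul, mul_one]
    rfl
  have := hτ.nonneg c
  rw [← hc, map_sub, e3, Complex.le_def] at this
  have := this.1
  rw [Complex.sub_re, Complex.ofReal_re] at this
  simpa using this

/-- A point in the spectrum of a central element is the value there of some state. -/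
lemma exists_contractive_eq_of_mem_spectrum {c : B} (hc : ∀ x, Commute c x) {μ : ℂ}
    (hμ : μ ∈ spectrum ℂ c) :
    ∃ φ : B →ₗ[ℂ] ℂ, (∀ x, ‖φ x‖ ≤ ‖x‖) ∧ φ 1 = 1 ∧ φ c = μ := by
  set d := algebraMap ℂ B μ - c with hd
  have hdu : ¬ IsUnit d := hμ
  have hdc : ∀ x, Commute d x := fun x => (Algebra.commute_algebraMap_left μ x).sub_left (hc x)
  -- S is the proper ideal Bd. The functional will be a norming functional for the class of 1 in
  -- B/S; it vanishes at d = μ - c, which gives the value μ at c.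
  let S : Submodule ℂ B := LinearMap.range (LinearMap.mulRight ℂ d)
  obtain ⟨g, hg, hg1⟩ := exists_dual_vector'' ℂ (Submodule.Quotient.mk (p := S) (1 : B))
  have hn : ‖Submodule.Quotient.mk (p := S) (1 : B)‖ = 1 := by
    have : Nontrivial B := by
      by_contra hB
      rw [not_nontrivial_iff_subsingleton] at hB
      exact hdu (isUnit_of_subsingleton d)
    refine le_antisymm ((Submodule.Quotient.norm_mk_le S 1).trans_eq norm_one) ?_
    -- A representative m of the class of 1 with ‖m‖ < 1 would make 1 - m an invertible element of
    -- Bd, and then the central element d would be invertible.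
    by_contra! hlt
    obtain ⟨m, hm, hm1⟩ := Submodule.Quotient.norm_mk_lt (Submodule.Quotient.mk (p := S) (1 : B))
      (sub_pos.2 hlt)
    rw [add_sub_cancel] at hm1
    obtain ⟨x, hx⟩ := (Submodule.Quotient.eq S).1 hm.symm
    have hu : IsUnit (d * x) := by
      rw [(hdc x).eq]
      have : x * d = 1 - m := hx
      rw [this]
      exact isUnit_one_sub_of_norm_lt_one hm1
    exact hdu ((hdc x).isUnit_mul_iff.1 hu).1
  refine ⟨g.toLinearMap ∘ₗ S.mkQ, fun x => ?_, ?_, ?_⟩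
  · exact (g.le_of_opNorm_le hg _).trans
      (by rw [one_mul]; exact Submodule.Quotient.norm_mk_le S x)
  · show g (Submodule.Quotient.mk 1) = 1
    rw [hg1, hn]; simp
  · have h0 : g (Submodule.Quotient.mk (p := S) d) = 0 := by
      rw [(Submodule.Quotient.mk_eq_zero S).2 ⟨1, by simp⟩, map_zero]
    rw [hd, Submodule.Quotient.mk_sub, map_sub, Algebra.algebraMap_eq_smul_one,
      Submodule.Quotient.mk_smul, map_smul, hg1, hn] at h0
    show g (Submodule.Quotient.mk c) = μ
    simpa using (sub_eq_zero.1 h0).symm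

/-- Averaging a contractive functional over the powers of a contraction `T` gives a `T`-invariant
contractive functional. -/
lemma exists_invariant_of_contraction (φ : B →ₗ[ℂ] ℂ) (hφ : ∀ x, ‖φ x‖ ≤ ‖x‖) (T : B →ₗ[ℂ] B)
    (hT : ∀ x, ‖T x‖ ≤ ‖x‖) :
    ∃ ψ : B →ₗ[ℂ] ℂ, (∀ x, ‖ψ x‖ ≤ ‖x‖) ∧ (∀ x, ψ (T x) = ψ x) ∧
      ∀ x z, (∀ k : ℕ, φ ((T ^ k) x) = z) → ψ x = z := by
  have hTk : ∀ (k : ℕ) x, ‖(T ^ k) x‖ ≤ ‖x‖ := fun k x => by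
    induction k with
    | zero => simp
    | succ k ih => rw [pow_succ', Module.End.mul_apply]; exact (hT _).trans ih
  let av : ℕ → B →ₗ[ℂ] ℂ := fun N => ((N : ℂ) + 1)⁻¹ • ∑ k ∈ Finset.range (N + 1), φ ∘ₗ (T ^ k)
  have hav : ∀ N x, av N x = ((N : ℂ) + 1)⁻¹ * ∑ k ∈ Finset.range (N + 1), φ ((T ^ k) x) :=
    fun N x => by simp [av]
  have hN : ∀ N : ℕ, ((N : ℂ) + 1) ≠ 0 := fun N => Nat.cast_add_one_ne_zero N
  have hnN : ∀ N : ℕ, ‖((N : ℂ) + 1)⁻¹‖ = ((N : ℝ) + 1)⁻¹ := fun N => by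
    rw [norm_inv]
    congr 1
    exact_mod_cast Complex.norm_natCast (N + 1)
  have hbd : ∀ N x, ‖av N x‖ ≤ ‖x‖ := fun N x => by
    rw [hav, norm_mul, hnN, inv_mul_le_iff₀ (by positivity)]
    refine (norm_sum_le _ _).trans ((Finset.sum_le_sum fun k _ =>
      (hφ _).trans (hTk k x)).trans_eq ?_)
    simp
  -- The averages need not converge; their limit is taken along a free ultrafilter, using
  -- compactness of the disc of radius ‖x‖.
  have hlim : ∀ x, ∃ z : ℂ, Filter.Tendsto (fun N => av N x)
      (Filter.hyperfilter ℕ : Filter ℕ) (nhds z) := fun x => by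
    obtain ⟨z, -, hz⟩ := (isCompact_closedBall (0 : ℂ) ‖x‖).ultrafilter_le_nhds
      ((Filter.hyperfilter ℕ).map fun N => av N x) (by
        rw [Ultrafilter.coe_map, Filter.le_principal_iff, Filter.mem_map]
        exact Filter.univ_mem' fun N => by simpa using hbd N x)
    exact ⟨z, hz⟩
  choose ψ hψ using hlim
  refine ⟨⟨⟨ψ, fun x y => ?_⟩, fun c x => ?_⟩, fun x => ?_, fun x => ?_, fun x z hz => ?_⟩
  · refine tendsto_nhds_unique (hψ (x + y)) ?_
    simpa only [map_add] using (hψ x).add (hψ y)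
  · refine tendsto_nhds_unique (hψ (c • x)) ?_
    simpa only [map_smul, RingHom.id_apply] using (hψ x).const_smul c
  · exact le_of_tendsto (hψ x).norm (Filter.Eventually.of_forall fun N => hbd N x)
  · refine tendsto_nhds_unique (hψ (T x)) ?_
    have hd : Filter.Tendsto (fun N => av N (T x) - av N x)
        (Filter.hyperfilter ℕ : Filter ℕ) (nhds 0) := by
      have h0 : Filter.Tendsto (fun N : ℕ => 2 * ‖x‖ * (1 / ((N : ℝ) + 1)))
          (Filter.hyperfilter ℕ : Filter ℕ) (nhds 0) := by
        have := (tendsto_one_div_add_atTop_nhds_zero_nat (𝕜 := ℝ)).const_mul (2 * ‖x‖)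
        rw [mul_zero] at this
        exact this.mono_left Nat.hyperfilter_le_atTop
      refine squeeze_zero_norm (fun N => ?_) h0
      -- The sum telescopes, leaving two boundary terms divided by N + 1.
      have : av N (T x) - av N x = ((N : ℂ) + 1)⁻¹ * (φ ((T ^ (N + 1)) x) - φ x) := by
        rw [hav, hav, ← mul_sub, ← Finset.sum_sub_distrib]
        congr 1
        have := Finset.sum_range_sub (fun k => φ ((T ^ k) x)) (N + 1)
        simpa only [pow_succ, Module.End.mul_apply, pow_zero, Module.End.one_apply] using this
      rw [this, norm_mul, hnN, mul_comm, one_div]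
      refine mul_le_mul_of_nonneg_right ?_ (by positivity)
      refine (norm_sub_le _ _).trans ?_
      have := (hφ _).trans (hTk (N + 1) x)
      have := hφ x
      linarith
    simpa using hd.add (hψ x)
  · refine tendsto_nhds_unique (hψ x) ?_
    have : (fun N => av N x) = fun _ => z := funext fun N => by
      rw [hav, Finset.sum_congr rfl fun k _ => hz k, Finset.sum_const, Finset.card_range,
        nsmul_eq_mul, ← mul_assoc]
      push_cast
      rw [inv_mul_cancel₀ (hN N), one_mul]
    rw [this]
    exact tendsto_const_nhds

/-- Conjugation by an element. -/
def conjLinear (u : B) : B →ₗ[ℂ] B := LinearMap.mulLeft ℂ u ∘ₗ LinearMap.mulRight ℂ (star u)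

lemma conjLinear_apply (u x : B) : conjLinear u x = u * (x * star u) := rfl

lemma norm_conjLinear_le {u : B} (hu : u ∈ unitary B) (x : B) : ‖conjLinear u x‖ ≤ ‖x‖ := by
  rw [conjLinear_apply, CStarRing.norm_mem_unitary_mul _ hu,
    CStarRing.norm_mul_mem_unitary _ (Unitary.star_mem hu)]

lemma conjLinear_of_commute {u x : B} (hu : u ∈ unitary B) (h : Commute u x) :
    conjLinear u x = x := by
  rw [conjLinear_apply, ← mul_assoc, h.eq, mul_assoc, Unitary.mul_star_self_of_mem hu, mul_one]

lemma conjLinear_pow_of_commute {u x : B} (hu : u ∈ unitary B) (h : Commute u x) (k : ℕ) :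
    (conjLinear u ^ k) x = x := by
  induction k with
  | zero => simp
  | succ k ih => rw [pow_succ, Module.End.mul_apply, conjLinear_of_commute hu h, ih]

/-- A functional invariant under conjugation by the unitary `u` satisfies `φ (u x) = φ (x u)`. -/
lemma map_mul_comm_of_conj_invariant {u : B} (hu : u ∈ unitary B) {φ : B →ₗ[ℂ] ℂ}
    (h : ∀ x, φ (conjLinear u x) = φ x) (x : B) : φ (u * x) = φ (x * u) := by
  rw [← h (x * u), conjLinear_apply, mul_assoc, Unitary.mul_star_self_of_mem hu, mul_one]

end States

/-! ### Central elements and the unique trace -/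

section Central

variable {B : Type*} [CStarAlgebra B] {u v : B}

/-- A closed set containing the ⋆-algebra generated by a generating pair is everything. -/
lemma induction_of_dense (hd : (StarAlgebra.adjoin ℂ {u, v}).topologicalClosure = ⊤)
    {P : Set B} (hP : IsClosed P) (h : ∀ x ∈ StarAlgebra.adjoin ℂ {u, v}, x ∈ P) (x : B) :
    x ∈ P := by
  have hx : x ∈ (StarAlgebra.adjoin ℂ {u, v}).topologicalClosure := hd ▸ trivial
  exact closure_minimal h hP hx

/-- The commutant of a single element need not be closed under the involution, so the induction
carries x and `star x` together. It starts because the adjoint of a unitary is its inverse. -/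
lemma commute_of_generators (hu : u ∈ unitary B) (hv : v ∈ unitary B)
    (hd : (StarAlgebra.adjoin ℂ {u, v}).topologicalClosure = ⊤) {c : B} (hcu : Commute c u)
    (hcv : Commute c v) (x : B) : Commute c x := by
  have star_unit : ∀ {w : B}, w ∈ unitary B → Commute c w → Commute c (star w) := by
    intro w hw hc
    have h1 := Unitary.mul_star_self_of_mem hw
    have h2 := Unitary.star_mul_self_of_mem hw
    calc c * star w = star w * w * c * star w := by rw [h2, one_mul]
      _ = star w * (c * w) * star w := by rw [hc.eq]; simp only [mul_assoc]
      _ = star w * c := by rw [← mul_assoc, mul_assoc, h1, mul_one]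
  refine induction_of_dense (P := {x | c * x = x * c}) hd
    (isClosed_eq (by fun_prop) (by fun_prop)) (fun x hx => ?_) x
  suffices Commute c x ∧ Commute c (star x) from this.1.eq
  induction hx using StarAlgebra.adjoin_induction with
  | mem x hx =>
    rcases hx with rfl | rfl
    · exact ⟨hcu, star_unit hu hcu⟩
    · exact ⟨hcv, star_unit hv hcv⟩
  | algebraMap r =>
    exact ⟨Algebra.commute_algebraMap_right r c, by
      rw [← algebraMap_star_comm]; exact Algebra.commute_algebraMap_right _ c⟩
  | add x y _ _ hx hy => exact ⟨hx.1.add_right hy.1, by rw [star_add]; exact hx.2.add_right hy.2⟩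
  | mul x y _ _ hx hy => exact ⟨hx.1.mul_right hy.1, by rw [star_mul]; exact hy.2.mul_right hx.2⟩
  | star x _ hx => exact ⟨hx.2, by rw [star_star]; exact hx.1⟩

/-- A contractive functional that commutes with the generators is tracial. -/
lemma map_mul_comm_of_generators (hu : u ∈ unitary B) (hv : v ∈ unitary B)
    (hd : (StarAlgebra.adjoin ℂ {u, v}).topologicalClosure = ⊤) {φ : B →ₗ[ℂ] ℂ}
    (hφ : ∀ x, ‖φ x‖ ≤ ‖x‖) (hφu : ∀ x, φ (u * x) = φ (x * u))
    (hφv : ∀ x, φ (v * x) = φ (x * v)) (a b : B) : φ (a * b) = φ (b * a) := by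
  have hcont : Continuous φ := AddMonoidHomClass.continuous_of_bound φ 1 (by simpa using hφ)
  have star_unit : ∀ {w : B}, w ∈ unitary B → (∀ x, φ (w * x) = φ (x * w)) →
      ∀ x, φ (star w * x) = φ (x * star w) := by
    intro w hw h x
    have h1 := Unitary.mul_star_self_of_mem hw
    have h2 := Unitary.star_mul_self_of_mem hw
    have := h (star w * x * star w)
    rw [← mul_assoc, ← mul_assoc, h1, one_mul, mul_assoc, h2, mul_one] at this
    exact this.symm
  refine induction_of_dense (P := {a | φ (a * b) = φ (b * a)}) hd
    (isClosed_eq (by fun_prop) (by fun_prop)) (fun x hx => ?_) a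
  suffices (∀ b, φ (x * b) = φ (b * x)) ∧ ∀ b, φ (star x * b) = φ (b * star x) from this.1 b
  have mul_aux : ∀ x y : B, (∀ b, φ (x * b) = φ (b * x)) → (∀ b, φ (y * b) = φ (b * y)) →
      ∀ b, φ (x * y * b) = φ (b * (x * y)) := fun x y hx hy b => by
    rw [mul_assoc, hx, mul_assoc, hy, mul_assoc]
  have alg_aux : ∀ (r : ℂ) b, φ (algebraMap ℂ B r * b) = φ (b * algebraMap ℂ B r) :=
    fun r b => by rw [Algebra.commutes]
  induction hx using StarAlgebra.adjoin_induction with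
  | mem x hx =>
    rcases hx with rfl | rfl
    · exact ⟨hφu, star_unit hu hφu⟩
    · exact ⟨hφv, star_unit hv hφv⟩
  | algebraMap r => exact ⟨alg_aux r, by rw [← algebraMap_star_comm]; exact alg_aux _⟩
  | add x y _ _ hx hy =>
    simp only [star_add, add_mul, mul_add, map_add]
    exact ⟨fun b => by rw [hx.1, hy.1], fun b => by rw [hx.2, hy.2]⟩
  | mul x y _ _ hx hy =>
    exact ⟨mul_aux x y hx.1 hy.1, by rw [star_mul]; exact mul_aux _ _ hy.2 hx.2⟩
  | star x _ hx => exact ⟨hx.2, by rw [star_star]; exact hx.1⟩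

/-- If `u v u⋆ v⋆` is central, every point in the spectrum of a central element is the value there
of a tracial state. -/
lemma exists_isTracialState_eq_of_mem_spectrum (hu : u ∈ unitary B) (hv : v ∈ unitary B)
    (hd : (StarAlgebra.adjoin ℂ {u, v}).topologicalClosure = ⊤)
    (hw : ∀ x, Commute (u * v * star u * star v) x) {c : B} (hc : ∀ x, Commute c x) {μ : ℂ}
    (hμ : μ ∈ spectrum ℂ c) : ∃ τ : B →ₗ[ℂ] ℂ, IsTracialState τ ∧ τ c = μ := by
  obtain ⟨φ, hφ, h1, hφc⟩ := exists_contractive_eq_of_mem_spectrum hc hμ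
  obtain ⟨φ', hφ', hinv, hval⟩ := exists_invariant_of_contraction φ hφ (conjLinear u)
    (norm_conjLinear_le hu)
  obtain ⟨ψ, hψ, hinv', hval'⟩ := exists_invariant_of_contraction φ' hφ' (conjLinear v)
    (norm_conjLinear_le hv)
  -- Central elements are fixed by both conjugations, so neither averaging changes their value.
  have fixed : ∀ (x : B) (z : ℂ), (∀ y, Commute x y) → φ x = z → ψ x = z := fun x z hx hz =>
    hval' x z fun k => by
      rw [conjLinear_pow_of_commute hv (hx v).symm]
      exact hval x z fun k => by rw [conjLinear_pow_of_commute hu (hx u).symm, hz]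
  -- uv and vu differ by the central unitary w, so they induce the same conjugation.
  have hcomm : Commute (conjLinear u) (conjLinear v) := by
    ext x
    simp only [Module.End.mul_apply, conjLinear_apply]
    set w := u * v * star u * star v with hw'
    have hu1 := Unitary.star_mul_self_of_mem hu
    have hv1 := Unitary.star_mul_self_of_mem hv
    have huv : u * v = w * (v * u) := by
      rw [hw']
      simp only [mul_assoc]
      rw [← mul_assoc (star v) v, hv1, one_mul, hu1, mul_one]
    have hww : w ∈ unitary B := by
      rw [hw']
      exact mul_mem (mul_mem (mul_mem hu hv) (Unitary.star_mem hu)) (Unitary.star_mem hv)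
    calc u * (v * (x * star v) * star u) = (u * v) * x * star (u * v) := by
          rw [star_mul]; simp only [mul_assoc]
      _ = w * ((v * u) * x * star (v * u)) * star w := by
          rw [huv, star_mul w]; simp only [mul_assoc]
      _ = (v * u) * x * star (v * u) := by
          rw [(hw _).eq, mul_assoc, Unitary.mul_star_self_of_mem hww, mul_one]
      _ = v * (u * (x * star u) * star v) := by
          rw [star_mul]; simp only [mul_assoc]
  -- Averaging over v preserves invariance under u: the first functional vanishes on the whole
  -- v-orbit of uxu⋆ - x, because the conjugations commute.
  have hinvu : ∀ x, ψ (conjLinear u x) = ψ x := fun x => by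
    rw [← sub_eq_zero, ← map_sub]
    refine hval' _ _ fun k => ?_
    rw [map_sub, map_sub, ← Module.End.mul_apply, ← (hcomm.pow_right k).eq, Module.End.mul_apply,
      hinv, sub_self]
  have hψ1 : ψ 1 = 1 := fixed 1 1 (fun y => Commute.one_left y) h1
  refine ⟨ψ, ⟨nonneg_of_contractive_of_map_one ψ hψ hψ1, hψ1, ?_⟩, fixed c μ hc hφc⟩
  exact map_mul_comm_of_generators hu hv hd hψ (map_mul_comm_of_conj_invariant hu hinvu)
    (map_mul_comm_of_conj_invariant hv hinv')

/-- With a unique tracial state, central unitaries are scalars. -/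
lemma eq_algebraMap_of_unique_trace (hu : u ∈ unitary B) (hv : v ∈ unitary B)
    (hd : (StarAlgebra.adjoin ℂ {u, v}).topologicalClosure = ⊤)
    (hw : ∀ x, Commute (u * v * star u * star v) x)
    (hτ : ∃! τ : B →ₗ[ℂ] ℂ, IsTracialState τ) {c : B} (hcu : c ∈ unitary B)
    (hc : ∀ x, Commute c x) : ∃ μ : ℂ, ‖μ‖ = 1 ∧ c = algebraMap ℂ B μ := by
  obtain ⟨τ, hτ, huniq⟩ := hτ
  have : Nontrivial B := by
    by_contra hB
    rw [not_nontrivial_iff_subsingleton] at hB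
    have := hτ.map_one
    rw [Subsingleton.elim (1 : B) 0, map_zero] at this
    exact zero_ne_one this
  -- Normality gives access to the functional calculus, where one-point spectrum means scalar.
  have hn : IsStarNormal c := ⟨(hc (star c)).symm⟩
  have hsp : spectrum ℂ c ⊆ {τ c} := fun μ hμ => by
    obtain ⟨σ, hσ, hσc⟩ := exists_isTracialState_eq_of_mem_spectrum hu hv hd hw hc hμ
    rw [← hσc, huniq σ hσ]
    rfl
  have hcs : c = algebraMap ℂ B (τ c) := CFC.eq_algebraMap_of_spectrum_subset_singleton c _ hsp
  refine ⟨τ c, ?_, hcs⟩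
  rw [← norm_algebraMap' B (τ c), ← hcs, CStarRing.norm_of_mem_unitary hcu]

end Central

/-! ### Commutation up to a scalar -/

section Commutation

variable {B : Type*} [Ring B] [Algebra ℂ B]

lemma mul_pow_eq_smul {u x : B} {a : ℂ} (h : u * x = a • (x * u)) (k : ℕ) :
    u * x ^ k = a ^ k • (x ^ k * u) := by
  induction k with
  | zero => simp
  | succ k ih =>
    rw [pow_succ x, ← mul_assoc, ih, smul_mul_assoc, mul_assoc, h, mul_smul_comm, smul_smul,
      ← mul_assoc, pow_succ a]

lemma pow_mul_eq_smul {u x : B} {a : ℂ} (h : u * x = a • (x * u)) (k : ℕ) :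
    u ^ k * x = a ^ k • (x * u ^ k) := by
  induction k with
  | zero => simp
  | succ k ih =>
    rw [pow_succ' u, mul_assoc, ih, mul_smul_comm, ← mul_assoc, h, smul_mul_assoc, smul_smul,
      ← mul_assoc, mul_assoc x, pow_succ a]

end Commutation

/-! ### Root of unity case: matrix units -/

section Matrix

variable {B : Type*} [CStarAlgebra B]

lemma mul_star_eq_smul {u v : B} {a : ℂ} (hv : v ∈ unitary B) (ha : a ≠ 0)
    (h : u * v = a • (v * u)) : u * star v = a⁻¹ • (star v * u) := by
  have h1 := Unitary.mul_star_self_of_mem hv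
  have h2 := Unitary.star_mul_self_of_mem hv
  have : star v * u = a • (u * star v) := by
    calc star v * u = star v * (u * v) * star v := by rw [mul_assoc, mul_assoc, h1, mul_one]
      _ = a • (star v * v * (u * star v)) := by
        rw [h, mul_smul_comm, smul_mul_assoc]; simp only [mul_assoc]
      _ = a • (u * star v) := by rw [h2, one_mul]
  rw [this, smul_smul, inv_mul_cancel₀ ha, one_smul]

/-- A system of `n × n` matrix units in `B` induces a ⋆-homomorphism from the matrix algebra. -/
def StarAlgHom.ofMatrixUnits {n : ℕ} (e : Fin n → Fin n → B)
    (hmul : ∀ i j k l, e i j * e k l = if j = k then e i l else 0)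
    (hsum : ∑ i, e i i = 1) (hstar : ∀ i j, star (e i j) = e j i) :
    Matrix (Fin n) (Fin n) ℂ →⋆ₐ[ℂ] B :=
  { AlgHom.ofLinearMap
      ({ toFun := fun M => ∑ i, ∑ j, M i j • e i j
         map_add' := fun M N => by simp [add_smul, Finset.sum_add_distrib]
         map_smul' := fun c M => by simp [mul_smul, Finset.smul_sum] } :
        Matrix (Fin n) (Fin n) ℂ →ₗ[ℂ] B)
      (by simp [Matrix.one_apply, ite_smul, hsum])
      (fun M N => by
        simp only [LinearMap.coe_mk, AddHom.coe_mk, Matrix.mul_apply, Finset.sum_smul]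
        rw [Finset.sum_mul]
        refine Finset.sum_congr rfl fun i _ => ?_
        rw [Finset.sum_comm, Finset.sum_mul]
        refine Finset.sum_congr rfl fun j _ => ?_
        symm
        rw [Finset.mul_sum, Finset.sum_eq_single_of_mem j (Finset.mem_univ j)]
        · simp only [Finset.mul_sum, smul_mul_smul_comm, hmul, if_true]
        · intro k _ hk
          simp only [Finset.mul_sum, smul_mul_smul_comm, hmul, hk.symm, if_false, smul_zero,
            Finset.sum_const_zero]) with
    map_star' := fun M => by
      simp only [AlgHom.toRingHom_eq_coe, RingHom.toMonoidHom_eq_coe, OneHom.toFun_eq_coe,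
        MonoidHom.toOneHom_coe, MonoidHom.coe_coe, RingHom.coe_coe, AlgHom.ofLinearMap_apply,
        LinearMap.coe_mk, AddHom.coe_mk, star_sum, star_smul, hstar, Matrix.star_apply]
      rw [Finset.sum_comm] }

lemma StarAlgHom.ofMatrixUnits_apply {n : ℕ} (e : Fin n → Fin n → B)
    (hmul : ∀ i j k l, e i j * e k l = if j = k then e i l else 0)
    (hsum : ∑ i, e i i = 1) (hstar : ∀ i j, star (e i j) = e j i)
    (M : Matrix (Fin n) (Fin n) ℂ) :
    StarAlgHom.ofMatrixUnits e hmul hsum hstar M = ∑ i, ∑ j, M i j • e i j := rfl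

/-- Two unitaries of order `n` commuting up to a primitive `n`-th root of unity generate the
matrix algebra `M_n(ℂ)`. -/
lemma nonempty_starAlgEquiv_matrix_of_pow_eq_one [Nontrivial B] {u v : B} (hu : u ∈ unitary B)
    (hv : v ∈ unitary B) (hd : (StarAlgebra.adjoin ℂ {u, v}).topologicalClosure = ⊤)
    {ω : ℂ} {n : ℕ} (hn : 0 < n) (hω : IsPrimitiveRoot ω n) (huv : u * v = ω • (v * u))
    (hun : u ^ n = 1) (hvn : v ^ n = 1) :
    Nonempty (B ≃⋆ₐ[ℂ] Matrix (Fin n) (Fin n) ℂ) := by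
  have hω0 : ω ≠ 0 := hω.ne_zero hn.ne'
  have hn0 : (n : ℂ) ≠ 0 := Nat.cast_ne_zero.2 hn.ne'
  have hu2 := Unitary.star_mul_self_of_mem hu
  have hvk : ∀ k : ℕ, star v ^ k * v ^ k = 1 := fun k => by
    rw [← star_pow]; exact Unitary.star_mul_self_of_mem (pow_mem hv k)
  have hvk' : ∀ k : ℕ, v ^ k * star v ^ k = 1 := fun k => by
    rw [← star_pow]; exact Unitary.mul_star_self_of_mem (pow_mem hv k)
  -- As u^n = 1, this average is the spectral projection of u for the eigenvalue 1.
  set p : B := (n : ℂ)⁻¹ • ∑ k ∈ Finset.range n, u ^ k with hp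
  have hup : u * p = p := by
    rw [hp, mul_smul_comm, Finset.mul_sum]
    congr 1
    have h1 := Finset.sum_range_succ (fun k => u ^ k) n
    rw [Finset.sum_range_succ', hun, pow_zero] at h1
    simpa only [pow_succ'] using add_right_cancel h1
  have hpu : p * u = p := by
    rw [hp] at hup ⊢
    rw [smul_mul_assoc, ← (Commute.sum_right _ _ u fun k _ => Commute.self_pow u k).eq,
      ← mul_smul_comm, hup]
  have husp : star u * p = p := by
    conv_lhs => rw [← hup, ← mul_assoc, hu2, one_mul]
  -- This single identity gives both self-adjointness and idempotence of p.
  have hpp : star p * p = p := by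
    have : ∀ k : ℕ, star u ^ k * p = p := fun k => by
      induction k with
      | zero => simp
      | succ k ih => rw [pow_succ, mul_assoc, husp, ih]
    conv_lhs => rw [hp]
    rw [star_smul, star_sum, smul_mul_assoc, Finset.sum_mul,
      Finset.sum_congr rfl fun k _ => by rw [star_pow, this k], Finset.sum_const,
      Finset.card_range, ← Nat.cast_smul_eq_nsmul ℂ, smul_smul]
    simp [hn0]
  have hps : star p = p := by
    conv_rhs => rw [← hpp]
    conv_lhs => rw [← hpp, star_mul, star_star]
  rw [hps] at hpp
  clear_value p
  have husv := mul_star_eq_smul hv hω0 huv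
  -- Conjugating by v^i turns p into the projection for the eigenvalue ω^i, and v^i p v^{-j} is the
  -- partial isometry between two eigenspaces.
  let e : Fin n → Fin n → B := fun i j => v ^ (i : ℕ) * p * star v ^ (j : ℕ)
  have hpvp : ∀ i j : Fin n, p * (star v ^ (i : ℕ) * v ^ (j : ℕ)) * p = if i = j then p else 0 := by
    intro i j
    split_ifs with hij
    · rw [hij, hvk, mul_one, hpp]
    · set x := p * (star v ^ (i : ℕ) * v ^ (j : ℕ)) * p with hx
      -- A factor u is absorbed by p on either side; carrying it from left to right multiplies x by
      -- ω^{j-i}, which is not 1 for i ≠ j.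
      have hxx : x = (ω⁻¹ ^ (i : ℕ) * ω ^ (j : ℕ)) • x := by
        calc x = p * u * (star v ^ (i : ℕ) * v ^ (j : ℕ)) * p := by rw [hpu]
          _ = p * (u * star v ^ (i : ℕ) * v ^ (j : ℕ)) * p := by simp only [mul_assoc]
          _ = ω⁻¹ ^ (i : ℕ) • (p * (star v ^ (i : ℕ) * (u * v ^ (j : ℕ))) * p) := by
            rw [mul_pow_eq_smul husv, smul_mul_assoc, mul_smul_comm, smul_mul_assoc,
              mul_assoc _ u]
          _ = (ω⁻¹ ^ (i : ℕ) * ω ^ (j : ℕ)) • (p * (star v ^ (i : ℕ) * v ^ (j : ℕ)) * (u * p)) := by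
            rw [mul_pow_eq_smul huv, mul_smul_comm, mul_smul_comm, smul_mul_assoc, smul_smul]
            simp only [mul_assoc]
          _ = (ω⁻¹ ^ (i : ℕ) * ω ^ (j : ℕ)) • x := by rw [hup]
      have hne : (1 - ω⁻¹ ^ (i : ℕ) * ω ^ (j : ℕ)) ≠ 0 := fun h => by
        rw [sub_eq_zero, inv_pow, eq_comm, inv_mul_eq_one₀ (pow_ne_zero _ hω0)] at h
        exact hij (Fin.ext (hω.pow_inj i.2 j.2 h))
      have : (1 - ω⁻¹ ^ (i : ℕ) * ω ^ (j : ℕ)) • x = 0 := by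
        rw [sub_smul, one_smul, ← hxx, sub_self]
      exact (smul_eq_zero.1 this).resolve_left hne
  have hmul : ∀ i j k l, e i j * e k l = if j = k then e i l else 0 := by
    intro i j k l
    have : e i j * e k l
        = v ^ (i : ℕ) * (p * (star v ^ (j : ℕ) * v ^ (k : ℕ)) * p) * star v ^ (l : ℕ) := by
      simp only [e, mul_assoc]
    rw [this, hpvp]
    split_ifs <;> simp [e]
  have hstar : ∀ i j, star (e i j) = e j i := fun i j => by
    simp [e, star_mul, star_pow, hps, mul_assoc]
  -- Expanding p gives a double sum in which the coefficient of u^k is a geometric sum over the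
  -- powers of ω^{-k}; it vanishes unless k = 0.
  have hsumN : ∑ i ∈ Finset.range n, v ^ i * p * star v ^ i = 1 := by
    have hconj : ∀ i k : ℕ, v ^ i * u ^ k * star v ^ i = ((ω⁻¹) ^ k) ^ i • u ^ k := fun i k => by
      rw [mul_assoc, mul_pow_eq_smul (pow_mul_eq_smul husv k), mul_smul_comm, ← mul_assoc, hvk',
        one_mul]
    have : ∀ i : ℕ, v ^ i * p * star v ^ i
        = (n : ℂ)⁻¹ • ∑ k ∈ Finset.range n, ((ω⁻¹) ^ k) ^ i • u ^ k := fun i => by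
      rw [hp, mul_smul_comm, smul_mul_assoc, Finset.mul_sum, Finset.sum_mul]
      simp only [hconj]
    simp only [this]
    rw [← Finset.smul_sum, Finset.sum_comm]
    simp only [← Finset.sum_smul]
    rw [Finset.sum_eq_single_of_mem 0 (Finset.mem_range.2 hn)]
    · simp [smul_smul, hn0]
    · intro k hk hk0
      have h1 : (ω⁻¹ ^ k) ≠ 1 := by
        rw [inv_pow, inv_ne_one]
        exact hω.pow_ne_one_of_pos_of_lt hk0 (Finset.mem_range.1 hk)
      have h2 := geom_sum_mul (ω⁻¹ ^ k) n
      rw [← pow_mul, mul_comm k n, pow_mul, inv_pow ω n, hω.pow_eq_one, inv_one, one_pow,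
        sub_self] at h2
      rw [(mul_eq_zero.1 h2).resolve_right (sub_ne_zero.2 h1), zero_smul]
  have hsum : ∑ i, e i i = 1 := by
    rw [← hsumN, Finset.sum_range]
  let φ := StarAlgHom.ofMatrixUnits e hmul hsum hstar
  have hφe : ∀ i j, e i j ∈ φ.range := fun i j => by
    refine ⟨Matrix.single i j 1, ?_⟩
    show StarAlgHom.ofMatrixUnits e hmul hsum hstar _ = _
    rw [StarAlgHom.ofMatrixUnits_apply, Finset.sum_eq_single_of_mem i (Finset.mem_univ i),
      Finset.sum_eq_single_of_mem j (Finset.mem_univ j)]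
    · simp
    · intro l _ hl
      rw [Matrix.single_apply_of_ne _ _ _ _ _ (by tauto), zero_smul]
    · intro k _ hk
      exact Finset.sum_eq_zero fun l _ => by
        rw [Matrix.single_apply_of_ne _ _ _ _ _ (by tauto), zero_smul]
  have hmu : u ∈ φ.range := by
    -- In these units u is diagonal with entries ω^i and, below, v is the cyclic shift, whose
    -- wrap-around uses v^n = 1.
    have : u = ∑ i : Fin n, ω ^ (i : ℕ) • e i i := by
      conv_lhs => rw [← mul_one u, ← hsum, Finset.mul_sum]
      refine Finset.sum_congr rfl fun i _ => ?_
      simp only [e]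
      rw [← mul_assoc, ← mul_assoc, mul_pow_eq_smul huv, smul_mul_assoc, smul_mul_assoc,
        mul_assoc _ u, hup]
    rw [this]
    exact sum_mem fun i _ => φ.range.smul_mem (hφe i i) _
  have hmv : v ∈ φ.range := by
    have : v = ∑ i : Fin n, e ⟨((i : ℕ) + 1) % n, Nat.mod_lt _ hn⟩ i := by
      conv_lhs => rw [← mul_one v, ← hsum, Finset.mul_sum]
      refine Finset.sum_congr rfl fun i _ => ?_
      simp only [e]
      rw [← mul_assoc, ← mul_assoc, ← pow_succ', ← pow_mod_orderOf,
        ← Nat.mod_mod_of_dvd _ (orderOf_dvd_of_pow_eq_one hvn), pow_mod_orderOf]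
    rw [this]
    exact sum_mem fun i _ => hφe _ i
  have hsurj : Function.Surjective φ := by
    have hle : StarAlgebra.adjoin ℂ {u, v} ≤ φ.range := by
      rw [StarAlgebra.adjoin_le_iff]
      rintro x (rfl | rfl)
      · exact hmu
      · exact hmv
    have hcl : IsClosed (φ.range : Set B) := by
      have : (φ.range : Set B) = (LinearMap.range φ.toAlgHom.toLinearMap : Set B) := rfl
      rw [this]
      exact Submodule.closed_of_finiteDimensional _
    intro x
    have hx : x ∈ (StarAlgebra.adjoin ℂ {u, v}).topologicalClosure := hd ▸ trivial
    exact closure_minimal hle hcl hx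
  have : NeZero n := ⟨hn.ne'⟩
  -- The matrix algebra is simple and B is nontrivial.
  have hinj : Function.Injective φ := RingHom.injective (φ : Matrix (Fin n) (Fin n) ℂ →+* B)
  exact ⟨(StarAlgEquiv.ofBijective φ ⟨hinj, hsurj⟩).symm⟩

lemma adjoin_pair_le_adjoin_smul {u v : B} {a b : ℂ} (ha : a ≠ 0) (hb : b ≠ 0) :
    StarAlgebra.adjoin ℂ {u, v} ≤ StarAlgebra.adjoin ℂ {a • u, b • v} := by
  rw [StarAlgebra.adjoin_le_iff]
  rintro x (rfl | rfl)
  · have := (StarAlgebra.adjoin ℂ {a • x, b • v}).smul_mem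
      (StarAlgebra.subset_adjoin ℂ _ (by simp : a • x ∈ _)) a⁻¹
    rwa [inv_smul_smul₀ ha] at this
  · have := (StarAlgebra.adjoin ℂ {a • u, b • x}).smul_mem
      (StarAlgebra.subset_adjoin ℂ _ (by simp : b • x ∈ _)) b⁻¹
    rwa [inv_smul_smul₀ hb] at this

/-- Every unitary whose `n`-th power is a scalar of modulus one becomes of order `n` after
multiplication by a scalar of modulus one. -/
lemma exists_smul_pow_eq_one {u : B} (hu : u ∈ unitary B) {n : ℕ} (hn : 0 < n) {μ : ℂ}
    (hμ : ‖μ‖ = 1) (h : u ^ n = algebraMap ℂ B μ) :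
    ∃ a : ℂ, a ≠ 0 ∧ a • u ∈ unitary B ∧ (a • u) ^ n = 1 := by
  obtain ⟨b, hb⟩ := IsAlgClosed.exists_pow_nat_eq μ hn
  have hb1 : ‖b‖ = 1 := by
    rw [← hb, norm_pow] at hμ
    exact (pow_eq_one_iff_of_nonneg (norm_nonneg b) hn.ne').1 hμ
  have hb0 : b ≠ 0 := norm_ne_zero_iff.1 (by rw [hb1]; exact one_ne_zero)
  refine ⟨b⁻¹, inv_ne_zero hb0, ?_, ?_⟩
  · refine Unitary.smul_mem_of_mem ?_ hu
    rw [Unitary.mem_iff_self_mul_star, Complex.star_def, Complex.mul_conj,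
      Complex.normSq_eq_norm_sq, norm_inv, hb1]
    simp
  · rw [smul_pow, h, ← hb, Algebra.algebraMap_eq_smul_one, smul_smul, inv_pow,
      inv_mul_cancel₀ (pow_ne_zero _ hb0), one_smul]

/-- Two unitaries whose `n`-th powers are scalars and which commute up to a primitive `n`-th root
of unity generate the matrix algebra `M_n(ℂ)`. -/
lemma nonempty_starAlgEquiv_matrix [Nontrivial B] {u v : B} (hu : u ∈ unitary B)
    (hv : v ∈ unitary B) (hd : (StarAlgebra.adjoin ℂ {u, v}).topologicalClosure = ⊤)
    {ω : ℂ} {n : ℕ} (hn : 0 < n) (hω : IsPrimitiveRoot ω n) (huv : u * v = ω • (v * u))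
    {μ ν : ℂ} (hμ : ‖μ‖ = 1) (hν : ‖ν‖ = 1) (hun : u ^ n = algebraMap ℂ B μ)
    (hvn : v ^ n = algebraMap ℂ B ν) : Nonempty (B ≃⋆ₐ[ℂ] Matrix (Fin n) (Fin n) ℂ) := by
  obtain ⟨a, ha, hau, han⟩ := exists_smul_pow_eq_one hu hn hμ hun
  obtain ⟨b, hb, hbv, hbn⟩ := exists_smul_pow_eq_one hv hn hν hvn
  refine nonempty_starAlgEquiv_matrix_of_pow_eq_one hau hbv ?_ hn hω ?_ han hbn
  · rw [eq_top_iff, ← hd]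
    exact StarSubalgebra.topologicalClosure_mono (adjoin_pair_le_adjoin_smul ha hb)
  · rw [smul_mul_smul_comm, huv, smul_mul_smul_comm, smul_comm, mul_comm a b]

end Matrix

/-! ### Monomials, Laurent polynomials and Bessel's inequality -/

section Monomials

variable {B : Type*} [CStarAlgebra B]

/-- The monomial `u^j v^k`. -/
def monomialUV (u v : unitary B) (p : ℤ × ℤ) : B := ((u ^ p.1 * v ^ p.2 : unitary B) : B)

/-- The scalar unitary attached to a complex number of modulus one. -/
def scalarUnitary (B : Type*) [CStarAlgebra B] (ω : unitary ℂ) : unitary B :=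
  Unitary.map (.ofClass (StarAlgHom.ofId ℂ B)) ω

lemma coe_scalarUnitary_zpow (ω : unitary ℂ) (m : ℤ) :
    ((scalarUnitary B ω ^ m : unitary B) : B) = algebraMap ℂ B ((ω : ℂ) ^ m) := by
  rw [scalarUnitary, ← map_zpow, Unitary.coe_map, Unitary.coe_zpow]
  rfl

lemma coe_scalarUnitary_zpow_mul (ω : unitary ℂ) (m : ℤ) (g : unitary B) :
    ((scalarUnitary B ω ^ m * g : unitary B) : B) = (ω : ℂ) ^ m • (g : B) := by
  rw [Submonoid.coe_mul, coe_scalarUnitary_zpow, Algebra.smul_def]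

lemma scalarUnitary_commute (ω : unitary ℂ) (g : unitary B) : Commute (scalarUnitary B ω) g := by
  refine Subtype.ext ?_
  have := coe_scalarUnitary_zpow (B := B) ω 1
  rw [zpow_one] at this
  rw [Submonoid.coe_mul, Submonoid.coe_mul, this, Algebra.commutes]

/-- Conjugation by u sends v to zv, hence v^k to z^k v^k; read backwards, conjugation by v^{-k}
sends u to z^k u, hence u^j to z^{kj} u^j. -/
lemma zpow_mul_zpow_of_central {G : Type*} [Group G] {z u v : G} (hz : ∀ g, Commute z g)
    (h : u * v = z * (v * u)) (j k : ℤ) : u ^ j * v ^ k = z ^ (j * k) * (v ^ k * u ^ j) := by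
  have h1 : u * v ^ k = z ^ k * (v ^ k * u) := by
    have : u * v * u⁻¹ = z * v := by rw [h]; group
    have h2 := conj_zpow (a := u) (b := v) (i := k)
    rw [this, (hz v).mul_zpow, eq_mul_inv_iff_mul_eq] at h2
    rw [← h2, mul_assoc]
  have : (v ^ k)⁻¹ * u * ((v ^ k)⁻¹)⁻¹ = z ^ k * u := by
    rw [inv_inv, mul_assoc, h1, ← mul_assoc, ← ((hz _).zpow_left k).eq]; group
  have h2 := conj_zpow (a := (v ^ k)⁻¹) (b := u) (i := j)
  rw [this, ((hz u).zpow_left k).mul_zpow, inv_inv, ← zpow_mul] at h2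
  calc u ^ j * v ^ k = v ^ k * ((v ^ k)⁻¹ * u ^ j * v ^ k) := by group
    _ = v ^ k * (z ^ (k * j) * u ^ j) := by rw [h2]
    _ = z ^ (j * k) * (v ^ k * u ^ j) := by
      rw [← mul_assoc, ← ((hz _).zpow_left _).eq, mul_comm k j, mul_assoc]

variable {u v : unitary B} {ω : unitary ℂ}

lemma coe_mul_eq_scalarUnitary (huv : (u : B) * v = (ω : ℂ) • ((v : B) * u)) :
    u * v = scalarUnitary B ω * (v * u) := by
  refine Subtype.ext ?_
  have := coe_scalarUnitary_zpow_mul ω 1 (v * u)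
  rw [zpow_one, zpow_one] at this
  rw [this, Submonoid.coe_mul, Submonoid.coe_mul, huv]

lemma zpow_mul_zpow_eq (huv : (u : B) * v = (ω : ℂ) • ((v : B) * u)) (j k : ℤ) :
    u ^ j * v ^ k = scalarUnitary B ω ^ (j * k) * (v ^ k * u ^ j) :=
  zpow_mul_zpow_of_central (scalarUnitary_commute ω) (coe_mul_eq_scalarUnitary huv) j k

lemma zpow_mul_zpow_eq' (huv : (u : B) * v = (ω : ℂ) • ((v : B) * u)) (j k : ℤ) :
    v ^ k * u ^ j = scalarUnitary B ω ^ (-(j * k)) * (u ^ j * v ^ k) := by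
  rw [zpow_mul_zpow_eq huv]; group

lemma monomialUV_mul (huv : (u : B) * v = (ω : ℂ) • ((v : B) * u)) (p q : ℤ × ℤ) :
    monomialUV u v p * monomialUV u v q = (ω : ℂ) ^ (-(q.1 * p.2)) • monomialUV u v (p + q) := by
  simp only [monomialUV]
  rw [← Submonoid.coe_mul, ← coe_scalarUnitary_zpow_mul]
  congr 1
  have hz := (scalarUnitary_commute ω (u ^ p.1)).zpow_left (-(q.1 * p.2))
  calc u ^ p.1 * v ^ p.2 * (u ^ q.1 * v ^ q.2) = u ^ p.1 * (v ^ p.2 * u ^ q.1) * v ^ q.2 := by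
        simp only [mul_assoc]
    _ = scalarUnitary B ω ^ (-(q.1 * p.2)) * (u ^ (p + q).1 * v ^ (p + q).2) := by
        rw [zpow_mul_zpow_eq' huv, ← mul_assoc (u ^ p.1), ← hz.eq, Prod.fst_add, Prod.snd_add,
          zpow_add, zpow_add]
        simp only [mul_assoc]

lemma star_monomialUV (huv : (u : B) * v = (ω : ℂ) • ((v : B) * u)) (p : ℤ × ℤ) :
    star (monomialUV u v p) = (ω : ℂ) ^ (-(p.1 * p.2)) • monomialUV u v (-p) := by
  simp only [monomialUV]
  rw [← coe_scalarUnitary_zpow_mul, ← Unitary.coe_star, Unitary.star_eq_inv, mul_inv_rev,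
    ← zpow_neg, ← zpow_neg, zpow_mul_zpow_eq' huv, Prod.fst_neg, Prod.snd_neg, neg_mul_neg]

lemma norm_monomialUV_le (p : ℤ × ℤ) : ‖monomialUV u v p‖ ≤ 1 := by
  rcases subsingleton_or_nontrivial B with _ | _
  · rw [Subsingleton.elim (monomialUV u v p) 0, norm_zero]; exact zero_le_one
  · exact (CStarRing.norm_coe_unitary _).le

/-- A tracial state kills all nontrivial monomials. -/
lemma IsTracialState.monomialUV_eq_zero {τ : B →ₗ[ℂ] ℂ} (hτ : IsTracialState τ)
    (huv : (u : B) * v = (ω : ℂ) • ((v : B) * u)) (hω : ∀ k : ℤ, k ≠ 0 → (ω : ℂ) ^ k ≠ 1)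
    {p : ℤ × ℤ} (hp : p ≠ 0) : τ (monomialUV u v p) = 0 := by
  have conj : ∀ g : unitary B, τ (((g * (u ^ p.1 * v ^ p.2) * g⁻¹ : unitary B)) : B)
      = τ (monomialUV u v p) := fun g => by
    rw [Submonoid.coe_mul, hτ.map_mul_comm, ← Submonoid.coe_mul, ← mul_assoc, inv_mul_cancel,
      one_mul, monomialUV]
  -- Conjugation preserves the trace but multiplies a monomial by a power of ω. Conjugating by u
  -- detects the exponent of v; if that exponent is zero, conjugating by v detects the exponent of
  -- u.
  have key : ∀ m : ℤ, m ≠ 0 → τ (monomialUV u v p) = (ω : ℂ) ^ m * τ (monomialUV u v p) →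
      τ (monomialUV u v p) = 0 := fun m hm h => by
    have : (1 - (ω : ℂ) ^ m) * τ (monomialUV u v p) = 0 := by rw [sub_mul, one_mul, ← h, sub_self]
    exact (mul_eq_zero.1 this).resolve_left (sub_ne_zero.2 (hω m hm).symm)
  have hcz : ∀ (m : ℤ) (g : unitary B), g * scalarUnitary B ω ^ m = scalarUnitary B ω ^ m * g :=
    fun m g => ((scalarUnitary_commute ω g).zpow_left m).eq.symm
  by_cases h2 : p.2 = 0
  · have h1 : p.1 ≠ 0 := fun h1 => hp (Prod.ext h1 h2)
    refine key (-p.1) (neg_ne_zero.2 h1) ?_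
    have e : v * (u ^ p.1 * v ^ p.2) * v⁻¹ = scalarUnitary B ω ^ (-p.1) * (u ^ p.1 * v ^ p.2) := by
      have := zpow_mul_zpow_eq' huv p.1 1
      rw [zpow_one, mul_one] at this
      rw [← mul_assoc, this]
      group
    conv_lhs => rw [← conj v, e, coe_scalarUnitary_zpow_mul, map_smul, smul_eq_mul]
    rfl
  · refine key p.2 h2 ?_
    have e : u * (u ^ p.1 * v ^ p.2) * u⁻¹ = scalarUnitary B ω ^ p.2 * (u ^ p.1 * v ^ p.2) := by
      have := zpow_mul_zpow_eq huv 1 p.2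
      rw [zpow_one, one_mul] at this
      calc u * (u ^ p.1 * v ^ p.2) * u⁻¹ = u ^ p.1 * (u * v ^ p.2) * u⁻¹ := by group
        _ = u ^ p.1 * scalarUnitary B ω ^ p.2 * v ^ p.2 := by rw [this]; group
        _ = scalarUnitary B ω ^ p.2 * (u ^ p.1 * v ^ p.2) := by rw [hcz, mul_assoc]
    conv_lhs => rw [← conj u, e, coe_scalarUnitary_zpow_mul, map_smul, smul_eq_mul]
    rfl

/-- The monomials are orthonormal for ⟨x, y⟩ = τ(x⋆y), since x⋆y is again a scalar multiple of a
monomial, nontrivial when the exponents differ. -/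
lemma IsTracialState.star_monomialUV_mul {τ : B →ₗ[ℂ] ℂ} (hτ : IsTracialState τ)
    (huv : (u : B) * v = (ω : ℂ) • ((v : B) * u)) (hω : ∀ k : ℤ, k ≠ 0 → (ω : ℂ) ^ k ≠ 1)
    (p q : ℤ × ℤ) :
    τ (star (monomialUV u v p) * monomialUV u v q) = if p = q then 1 else 0 := by
  split_ifs with h
  · rw [h, monomialUV, Unitary.coe_star_mul_self, hτ.map_one]
  · rw [star_monomialUV huv, smul_mul_assoc, monomialUV_mul huv, map_smul, map_smul,
      hτ.monomialUV_eq_zero huv hω, smul_zero, smul_zero]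
    rw [neg_add_eq_sub]
    exact sub_ne_zero.2 (Ne.symm h)

/-- Bessel's inequality for finite combinations of monomials. -/
lemma IsTracialState.sum_norm_sq_le {τ : B →ₗ[ℂ] ℂ} (hτ : IsTracialState τ)
    (huv : (u : B) * v = (ω : ℂ) • ((v : B) * u)) (hω : ∀ k : ℤ, k ≠ 0 → (ω : ℂ) ^ k ≠ 1)
    (F : Finset (ℤ × ℤ)) (a : ℤ × ℤ → ℂ) :
    ∑ p ∈ F, ‖a p‖ ^ 2 ≤ ‖∑ p ∈ F, a p • monomialUV u v p‖ ^ 2 := by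
  refine le_trans (le_of_eq ?_) (hτ.re_star_mul_self_le (∑ p ∈ F, a p • monomialUV u v p))
  have : τ (star (∑ p ∈ F, a p • monomialUV u v p) * ∑ p ∈ F, a p • monomialUV u v p)
      = ((∑ p ∈ F, ‖a p‖ ^ 2 : ℝ) : ℂ) := by
    rw [star_sum, Finset.sum_mul_sum, map_sum, Complex.ofReal_sum]
    refine Finset.sum_congr rfl fun p hp => ?_
    rw [map_sum, Finset.sum_eq_single_of_mem p hp]
    · rw [star_smul, smul_mul_smul_comm, map_smul, hτ.star_monomialUV_mul huv hω, if_pos rfl,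
        smul_eq_mul, mul_one, Complex.star_def, Complex.conj_mul']
      push_cast
      rfl
    · intro q _ hq
      rw [star_smul, smul_mul_smul_comm, map_smul, hτ.star_monomialUV_mul huv hω,
        if_neg hq.symm, smul_zero]
  rw [this, Complex.ofReal_re]

/-- The square of exponents `|j|, |k| ≤ D`. -/
def exponentBox (D : ℕ) : Finset (ℤ × ℤ) := Finset.Icc (-(D : ℤ)) D ×ˢ Finset.Icc (-(D : ℤ)) D

lemma mem_exponentBox {D : ℕ} {p : ℤ × ℤ} :
    p ∈ exponentBox D ↔ (-(D : ℤ) ≤ p.1 ∧ p.1 ≤ D) ∧ (-(D : ℤ) ≤ p.2 ∧ p.2 ≤ D) := by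
  simp [exponentBox]

lemma card_exponentBox (D : ℕ) : (exponentBox D).card = (2 * D + 1) ^ 2 := by
  rw [exponentBox, Finset.card_product, Int.card_Icc, sq]
  congr 1 <;> omega

/-- Laurent polynomials in `u`, `v` of degree at most `D` in each variable. -/
def laurentSpan (u v : unitary B) (D : ℕ) : Submodule ℂ B :=
  Submodule.span ℂ (monomialUV u v '' exponentBox D)

lemma monomialUV_mem_laurentSpan {D : ℕ} {p : ℤ × ℤ} (hp : p ∈ exponentBox D) :
    monomialUV u v p ∈ laurentSpan u v D :=
  Submodule.subset_span ⟨p, hp, rfl⟩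

lemma laurentSpan_mono {D E : ℕ} (h : D ≤ E) : laurentSpan u v D ≤ laurentSpan u v E := by
  refine Submodule.span_mono (Set.image_mono fun p hp => ?_)
  rw [Finset.mem_coe, mem_exponentBox] at hp ⊢
  omega

/-- Degrees add under products, so the degree of a power grows only linearly in the exponent. -/
lemma mul_mem_laurentSpan (huv : (u : B) * v = (ω : ℂ) • ((v : B) * u)) {D E : ℕ} {x y : B}
    (hx : x ∈ laurentSpan u v D) (hy : y ∈ laurentSpan u v E) :
    x * y ∈ laurentSpan u v (D + E) := by
  have h := Submodule.mul_mem_mul hx hy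
  rw [laurentSpan, laurentSpan, Submodule.span_mul_span] at h
  refine Submodule.span_le.2 ?_ h
  rintro _ ⟨_, ⟨p, hp, rfl⟩, _, ⟨q, hq, rfl⟩, rfl⟩
  simp only [monomialUV_mul huv]
  refine Submodule.smul_mem _ _ (monomialUV_mem_laurentSpan ?_)
  rw [Finset.mem_coe, mem_exponentBox] at hp hq
  rw [mem_exponentBox, Prod.fst_add, Prod.snd_add]
  push_cast
  omega

lemma star_mem_laurentSpan (huv : (u : B) * v = (ω : ℂ) • ((v : B) * u)) {D : ℕ} {x : B}
    (hx : x ∈ laurentSpan u v D) : star x ∈ laurentSpan u v D := by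
  induction hx using Submodule.span_induction with
  | mem x hx =>
    obtain ⟨p, hp, rfl⟩ := hx
    rw [star_monomialUV huv]
    refine Submodule.smul_mem _ _ (monomialUV_mem_laurentSpan ?_)
    rw [Finset.mem_coe, mem_exponentBox] at hp
    rw [mem_exponentBox, Prod.fst_neg, Prod.snd_neg]
    omega
  | zero => rw [star_zero]; exact zero_mem _
  | add x y _ _ hx hy => rw [star_add]; exact add_mem hx hy
  | smul c x _ hx => rw [star_smul]; exact Submodule.smul_mem _ _ hx

lemma one_mem_laurentSpan (D : ℕ) : (1 : B) ∈ laurentSpan u v D := by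
  have : (1 : B) = monomialUV u v 0 := by simp [monomialUV]
  rw [this]
  exact monomialUV_mem_laurentSpan (by rw [mem_exponentBox]; simp)

lemma pow_mem_laurentSpan (huv : (u : B) * v = (ω : ℂ) • ((v : B) * u)) {D : ℕ} {x : B}
    (hx : x ∈ laurentSpan u v D) (n : ℕ) : x ^ n ∈ laurentSpan u v (D * n) := by
  induction n with
  | zero => rw [pow_zero]; exact one_mem_laurentSpan _
  | succ n ih => rw [pow_succ, mul_add, mul_one]; exact mul_mem_laurentSpan huv ih hx

end Monomials

/-! ### Polynomial growth forces isometry -/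

section Growth

/-- If a > b > 0, the exponential (a/b)^n outgrows the linear factor, in particular along n = 2^m.
For b = 0 the case m = 0 suffices. -/
lemma le_of_pow_le_linear_mul_pow {a b C : ℝ} (hb : 0 ≤ b)
    (h : ∀ m : ℕ, a ^ 2 ^ m ≤ (C * (2 ^ m : ℕ) + 1) * b ^ 2 ^ m) : a ≤ b := by
  by_contra! hlt
  rcases hb.eq_or_lt with rfl | hb
  · have := h 0
    simp at this
    linarith
  have hr : 1 < a / b := (one_lt_div hb).2 hlt
  have hlim : Filter.Tendsto (fun n : ℕ => (C * n + 1) / (a / b) ^ n) Filter.atTop (nhds 0) := by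
    have h1 := (tendsto_pow_const_div_const_pow_of_one_lt 1 hr).const_mul C
    have h0 := tendsto_pow_const_div_const_pow_of_one_lt 0 hr
    have := h1.add h0
    simp only [mul_zero, add_zero, pow_one, pow_zero] at this
    refine this.congr fun n => ?_
    ring
  have hlim2 := hlim.comp (tendsto_pow_atTop_atTop_of_one_lt (one_lt_two : (1 : ℕ) < 2))
  obtain ⟨m, hm⟩ := (hlim2.eventually (gt_mem_nhds zero_lt_one)).exists
  have hpos : 0 < (a / b) ^ 2 ^ m := by positivity
  rw [Function.comp_apply, div_lt_one hpos, div_pow, lt_div_iff₀ (by positivity)] at hm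
  exact absurd (h m) (not_le.2 hm)

variable {R B : Type*} [CStarAlgebra R] [CStarAlgebra B] {U V : unitary R} {ω : unitary ℂ}

lemma map_monomialUV (π : R →⋆ₐ[ℂ] B) (p : ℤ × ℤ) :
    π (monomialUV U V p) = monomialUV (Unitary.map (.ofClass π) U) (Unitary.map (.ofClass π) V) p := by
  rw [monomialUV, monomialUV, ← map_zpow, ← map_zpow, ← map_mul, Unitary.coe_map]
  rfl

/-- On Laurent polynomials of degree `D`, a ⋆-homomorphism to a tracial algebra is bounded below
by a quantity of polynomial growth in `D`. -/
lemma norm_le_mul_norm_map {τ : B →ₗ[ℂ] ℂ} (hτ : IsTracialState τ)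
    (hω : ∀ k : ℤ, k ≠ 0 → (ω : ℂ) ^ k ≠ 1) (hUV : (U : R) * V = (ω : ℂ) • ((V : R) * U))
    (π : R →⋆ₐ[ℂ] B) {D : ℕ} {x : R} (hx : x ∈ laurentSpan U V D) :
    ‖x‖ ≤ (2 * D + 1) * ‖π x‖ := by
  have huv : ((Unitary.map (.ofClass π) U : unitary B) : B) * (Unitary.map (.ofClass π) V : unitary B)
      = (ω : ℂ) • (((Unitary.map (.ofClass π) V : unitary B) : B) * (Unitary.map (.ofClass π) U : unitary B)) := by
    simp only [Unitary.coe_map]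
    exact (map_mul π _ _).symm.trans ((congrArg π hUV).trans
      ((map_smul π _ _).trans (congrArg _ (map_mul π _ _))))
  obtain ⟨a, rfl⟩ := (Submodule.mem_span_image_finset_iff_exists_fun' ℂ).1 hx
  -- Three bounds combine: the triangle inequality in R, Cauchy–Schwarz over the (2D+1)² exponents,
  -- and Bessel in B. The factor 2D+1 is the square root of the number of exponents.
  have h1 : ‖∑ p ∈ exponentBox D, a p • monomialUV U V p‖ ≤ ∑ p ∈ exponentBox D, ‖a p‖ := by
    refine (norm_sum_le _ _).trans (Finset.sum_le_sum fun p _ => ?_)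
    rw [norm_smul]
    exact mul_le_of_le_one_right (norm_nonneg _) (norm_monomialUV_le p)
  have h2 := sq_sum_le_card_mul_sum_sq (s := exponentBox D) (f := fun p => ‖a p‖)
  rw [card_exponentBox] at h2
  have h3 := hτ.sum_norm_sq_le huv hω (exponentBox D) a
  have h4 : π (∑ p ∈ exponentBox D, a p • monomialUV U V p)
      = ∑ p ∈ exponentBox D, a p • monomialUV (Unitary.map (.ofClass π) U) (Unitary.map (.ofClass π) V) p := by
    simp only [map_sum, map_smul, map_monomialUV]
  rw [h4]
  refine h1.trans (abs_le_of_sq_le_sq' ?_ (by positivity)).2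
  rw [mul_pow]
  refine h2.trans ?_
  push_cast
  exact mul_le_mul_of_nonneg_left h3 (by positivity)

/-- A ⋆-homomorphism to a tracial algebra is isometric on Laurent polynomials. -/
lemma norm_le_norm_map_of_mem_laurentSpan {τ : B →ₗ[ℂ] ℂ} (hτ : IsTracialState τ)
    (hω : ∀ k : ℤ, k ≠ 0 → (ω : ℂ) ^ k ≠ 1) (hUV : (U : R) * V = (ω : ℂ) • ((V : R) * U))
    (π : R →⋆ₐ[ℂ] B) {D : ℕ} {x : R} (hx : x ∈ laurentSpan U V D) : ‖x‖ ≤ ‖π x‖ := by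
  have key : ‖star x * x‖ ≤ ‖π (star x * x)‖ := by
    -- The element x⋆x has degree D + D and its 2^m-th power has degree (D + D)·2^m. Being
    -- self-adjoint, it satisfies the norm identity for these powers exactly.
    refine le_of_pow_le_linear_mul_pow (C := 2 * (D + D)) (norm_nonneg _)
      fun m => ?_
    have hm := pow_mem_laurentSpan hUV (mul_mem_laurentSpan hUV (star_mem_laurentSpan hUV hx) hx)
      (2 ^ m)
    have := norm_le_mul_norm_map hτ hω hUV π hm
    rw [(IsSelfAdjoint.star_mul_self x).norm_pow_two_pow] at this
    refine this.trans ?_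
    push_cast
    rw [← mul_assoc, map_pow]
    exact mul_le_mul_of_nonneg_left (norm_pow_le' _ (by positivity)) (by positivity)
  rw [map_mul, map_star, CStarRing.norm_star_mul_self, CStarRing.norm_star_mul_self] at key
  exact le_of_sq_le_sq (by simpa only [sq] using key) (norm_nonneg _)

end Growth

/-! ### Universal property of the rotation algebra -/

namespace FreeUnitaryPair

variable {θ : ℝ} {B : Type*} [CStarAlgebra B]

/-- The algebra homomorphism from the free ⋆-algebra on two unitaries determined by a pair. -/
def liftAlgHom (θ : ℝ) (u v : unitary B) : FreeUnitaryPair θ →ₐ[ℂ] B :=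
  MonoidAlgebra.lift ℂ B (FreeGroup (Fin 2))
    ((unitary B).subtype.comp (FreeGroup.lift ![u, v]))

lemma liftAlgHom_single (u v : unitary B) (g : FreeGroup (Fin 2)) (c : ℂ) :
    liftAlgHom θ u v (single θ g c) = c • ((FreeGroup.lift ![u, v] g : unitary B) : B) :=
  MonoidAlgebra.lift_single ..

lemma liftAlgHom_star (u v : unitary B) (x : FreeUnitaryPair θ) :
    liftAlgHom θ u v (star x) = star (liftAlgHom θ u v x) := by
  refine induction_single x ?_ ?_ ?_
  · simp
  · intro g c
    rw [star_single, liftAlgHom_single, liftAlgHom_single, star_smul, map_inv,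
      ← Unitary.star_eq_inv, Unitary.coe_star]
  · intro x y hx hy
    rw [star_add, map_add, hx, hy, map_add, star_add]

lemma liftAlgHom_genU (u v : unitary B) : liftAlgHom θ u v (genU θ) = u := by
  rw [genU, liftAlgHom_single, one_smul, FreeGroup.lift_apply_of]
  rfl

lemma liftAlgHom_genV (u v : unitary B) : liftAlgHom θ u v (genV θ) = v := by
  rw [genV, liftAlgHom_single, one_smul, FreeGroup.lift_apply_of]
  rfl

/-- A concrete pair with the relation contributes one seminorm to the supremum defining the
universal norm, so the induced map is contractive. -/
lemma isRotationSeminorm_liftAlgHom (u v : unitary B)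
    (huv : (u : B) * v = Complex.exp (2 * Real.pi * Complex.I * θ) • ((v : B) * u)) :
    IsRotationSeminorm ((normSeminorm ℂ B).comp (liftAlgHom θ u v).toLinearMap) where
  mul_le x y := by
    simp only [Seminorm.comp_apply, AlgHom.toLinearMap_apply, coe_normSeminorm, map_mul]
    exact norm_mul_le _ _
  star_mul_self x := by
    simp only [Seminorm.comp_apply, AlgHom.toLinearMap_apply, coe_normSeminorm, map_mul,
      liftAlgHom_star]
    rw [CStarRing.norm_star_mul_self, sq]
  relation := by
    simp only [Seminorm.comp_apply, AlgHom.toLinearMap_apply, coe_normSeminorm, map_sub,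
      map_smul, map_mul, liftAlgHom_genU, liftAlgHom_genV]
    rw [huv, sub_self, norm_zero]

lemma norm_liftAlgHom_le (u v : unitary B)
    (huv : (u : B) * v = Complex.exp (2 * Real.pi * Complex.I * θ) • ((v : B) * u))
    (x : FreeUnitaryPair θ) : ‖liftAlgHom θ u v x‖ ≤ ‖x‖ :=
  le_univNorm (isRotationSeminorm_liftAlgHom u v huv) x

end FreeUnitaryPair

namespace RotationAlgebra

open UniformSpace FreeUnitaryPair

variable {θ : ℝ} {B : Type*} [CStarAlgebra B]

lemma mk_one : mk (1 : FreeUnitaryPair θ) = 1 := Completion.coe_one _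

/-- The universal property of the rotation algebra. -/
lemma exists_lift (u v : unitary B)
    (huv : (u : B) * v = Complex.exp (2 * Real.pi * Complex.I * θ) • ((v : B) * u)) :
    ∃ π : RotationAlgebra θ →⋆ₐ[ℂ] B, ∀ x, π (mk x) = liftAlgHom θ u v x := by
  have hc : Continuous (liftAlgHom θ u v : FreeUnitaryPair θ →+* B) :=
    AddMonoidHomClass.continuous_of_bound (liftAlgHom θ u v) 1 fun x => by
      rw [one_mul]; exact norm_liftAlgHom_le u v huv x
  let ρ : RotationAlgebra θ →+* B := Completion.extensionHom (liftAlgHom θ u v : _ →+* B) hc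
  have hρ : ∀ x, ρ (mk x) = liftAlgHom θ u v x := fun x => Completion.extensionHom_coe _ hc x
  have hρc : Continuous ρ := Completion.continuous_extension
  refine ⟨{ ρ with commutes' := fun c => ?_, map_star' := fun x => ?_ }, hρ⟩
  · show ρ (algebraMap ℂ _ c) = _
    rw [Algebra.algebraMap_eq_smul_one, ← mk_one, ← mk_smul, hρ, map_smul, map_one,
      Algebra.algebraMap_eq_smul_one]
  · show ρ (star x) = star (ρ x)
    refine denseRange_mk.induction_on x
      (isClosed_eq (hρc.comp continuous_star') (continuous_star.comp hρc)) fun a => ?_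
    rw [← mk_star, hρ, hρ, liftAlgHom_star]

/-- The unitary of the rotation algebra attached to a word in the generators. -/
def word (θ : ℝ) : FreeGroup (Fin 2) →* unitary (RotationAlgebra θ) where
  toFun g := ⟨mk (single θ g 1), by
    rw [Unitary.mem_iff, ← mk_star, star_single, ← mk_mul, ← mk_mul, single_mul_single,
      single_mul_single]
    simp [← one_def, mk_one]⟩
  map_one' := Subtype.ext mk_one
  map_mul' g h := Subtype.ext (by
    rw [Submonoid.coe_mul]
    simp only [← mk_mul, single_mul_single, mul_one])

lemma word_relation :
    (word θ (.of 0) : RotationAlgebra θ) * word θ (.of 1) =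
      Complex.exp (2 * Real.pi * Complex.I * θ) •
        ((word θ (.of 1) : RotationAlgebra θ) * word θ (.of 0)) := by
  have h : ‖mk (genU θ * genV θ -
      Complex.exp (2 * Real.pi * Complex.I * θ) • (genV θ * genU θ))‖ ≤ 0 := by
    rw [norm_mk]
    exact univNorm_le fun p hp => hp.relation.le
  rw [norm_le_zero_iff, sub_eq_add_neg, ← neg_smul, mk_add, mk_smul, mk_mul, mk_mul, neg_smul,
    ← sub_eq_add_neg, sub_eq_zero] at h
  exact h

/-- The relation reorders any word into a scalar multiple of a monomial; hence Laurent polynomials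
contain the image of the free algebra and are dense in A_θ. -/
lemma exists_mem_laurentSpan {ω : unitary ℂ}
    (hω : (ω : ℂ) = Complex.exp (2 * Real.pi * Complex.I * θ)) (x : FreeUnitaryPair θ) :
    ∃ D, mk x ∈ laurentSpan (word θ (.of 0)) (word θ (.of 1)) D := by
  have hrel := word_relation (θ := θ)
  rw [← hω] at hrel
  have hgen : ∀ p ∈ exponentBox 1, ∃ D, monomialUV (word θ (.of 0)) (word θ (.of 1)) p ∈
      laurentSpan (word θ (.of 0)) (word θ (.of 1)) D :=
    fun p hp => ⟨1, monomialUV_mem_laurentSpan hp⟩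
  have hword : ∀ g, ∃ D, (word θ g : RotationAlgebra θ) ∈
      laurentSpan (word θ (.of 0)) (word θ (.of 1)) D := fun g => by
    induction g using FreeGroup.induction_on with
    | C1 => exact ⟨0, by rw [map_one]; exact one_mem_laurentSpan 0⟩
    | of i =>
      fin_cases i
      · simpa [monomialUV] using hgen (1, 0) (by decide)
      · simpa [monomialUV] using hgen (0, 1) (by decide)
    | inv_of i _ =>
      fin_cases i
      · simpa [monomialUV] using hgen (-1, 0) (by decide)
      · simpa [monomialUV] using hgen (0, -1) (by decide)
    | mul g h hg hh =>
      obtain ⟨D, hD⟩ := hg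
      obtain ⟨E, hE⟩ := hh
      exact ⟨D + E, by rw [map_mul, Submonoid.coe_mul]; exact mul_mem_laurentSpan hrel hD hE⟩
  refine induction_single x ?_ ?_ ?_
  · exact ⟨0, by
      have : mk (0 : FreeUnitaryPair θ) = 0 := Completion.coe_zero
      rw [this]; exact zero_mem _⟩
  · intro g c
    obtain ⟨D, hD⟩ := hword g
    refine ⟨D, ?_⟩
    have : mk (single θ g c) = c • mk (single θ g 1) := by rw [← mk_smul, smul_single, mul_one]
    rw [this]
    exact Submodule.smul_mem _ _ hD
  · rintro x y ⟨D, hD⟩ ⟨E, hE⟩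
    refine ⟨max D E, ?_⟩
    rw [mk_add]
    exact add_mem (laurentSpan_mono (le_max_left _ _) hD) (laurentSpan_mono (le_max_right _ _) hE)

end RotationAlgebra

/-! ### The dichotomy for ω and the theorem -/

section Classification

variable {B : Type*} [CStarAlgebra B]

/-- A tracial C⋆-algebra generated by unitaries with `u v = e^{2πiθ} v u`, `e^{2πiθ}` not a root of
unity, is the rotation algebra. -/
lemma nonempty_starAlgEquiv_rotationAlgebra {u v : B} (hu : u ∈ unitary B) (hv : v ∈ unitary B)
    (hd : (StarAlgebra.adjoin ℂ {u, v}).topologicalClosure = ⊤) {τ : B →ₗ[ℂ] ℂ}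
    (hτ : IsTracialState τ) {θ : ℝ}
    (huv : u * v = Complex.exp (2 * Real.pi * Complex.I * θ) • (v * u))
    (hθ : ∀ k : ℤ, k ≠ 0 → Complex.exp (2 * Real.pi * Complex.I * θ) ^ k ≠ 1) :
    Nonempty (B ≃⋆ₐ[ℂ] RotationAlgebra θ) := by
  obtain ⟨π, hπ⟩ := RotationAlgebra.exists_lift (θ := θ) ⟨u, hu⟩ ⟨v, hv⟩ huv
  let ω : unitary ℂ := ⟨Complex.exp (2 * Real.pi * Complex.I * θ), by
    have : 2 * Real.pi * Complex.I * θ = ((2 * Real.pi * θ : ℝ) : ℂ) * Complex.I := by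
      push_cast; ring
    rw [Unitary.mem_iff_self_mul_star, Complex.star_def, Complex.mul_conj,
      Complex.normSq_eq_norm_sq, this, Complex.norm_exp_ofReal_mul_I]
    simp⟩
  have hπc : Continuous π := (AddMonoidHomClass.continuous_of_bound π 1 fun x => by
    rw [one_mul]; exact NonUnitalStarAlgHom.norm_apply_le π x)
  have hnorm : ∀ x, ‖x‖ ≤ ‖π x‖ := fun x => by
    refine RotationAlgebra.denseRange_mk.induction_on x
      (isClosed_le continuous_norm (continuous_norm.comp hπc)) fun a => ?_
    obtain ⟨D, hD⟩ := RotationAlgebra.exists_mem_laurentSpan (ω := ω) rfl a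
    exact norm_le_norm_map_of_mem_laurentSpan (ω := ω) hτ hθ RotationAlgebra.word_relation π hD
  have hiso : Isometry π := AddMonoidHomClass.isometry_of_norm π fun x =>
    le_antisymm (NonUnitalStarAlgHom.norm_apply_le π x) (hnorm x)
  have hsurj : Function.Surjective π := by
    have hle : StarAlgebra.adjoin ℂ {u, v} ≤ π.range := by
      rw [StarAlgebra.adjoin_le_iff]
      rintro x (rfl | rfl)
      · exact ⟨RotationAlgebra.mk (FreeUnitaryPair.genU θ),
          (hπ _).trans (FreeUnitaryPair.liftAlgHom_genU _ _)⟩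
      · exact ⟨RotationAlgebra.mk (FreeUnitaryPair.genV θ),
          (hπ _).trans (FreeUnitaryPair.liftAlgHom_genV _ _)⟩
    -- An isometric image of a complete space is closed, so density of the range gives surjectivity.
    have hcl : IsClosed (π.range : Set B) := by
      have : (π.range : Set B) = Set.range π := rfl
      rw [this]
      exact hiso.isClosedEmbedding.isClosed_range
    intro x
    have hx : x ∈ (StarAlgebra.adjoin ℂ {u, v}).topologicalClosure := hd ▸ trivial
    exact closure_minimal hle hcl hx
  exact ⟨(StarAlgEquiv.ofBijective π ⟨hiso.injective, hsurj⟩).symm⟩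

/-- A C⋆-algebra with a unique tracial state, generated by two unitaries with central commutator,
is an irrational rotation algebra or a full matrix algebra. -/
lemma classification_of_unique_trace {u v : B} (hu : u ∈ unitary B) (hv : v ∈ unitary B)
    (hd : (StarAlgebra.adjoin ℂ {u, v}).topologicalClosure = ⊤)
    (hcu : Commute (u * v * star u * star v) u) (hcv : Commute (u * v * star u * star v) v)
    (hτ : ∃! τ : B →ₗ[ℂ] ℂ, IsTracialState τ) :
    (∃ θ : ℝ, Irrational θ ∧ Nonempty (B ≃⋆ₐ[ℂ] RotationAlgebra θ)) ∨
    (∃ n : ℕ, 1 ≤ n ∧ Nonempty (B ≃⋆ₐ[ℂ] Matrix (Fin n) (Fin n) ℂ)) := by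
  have hw := commute_of_generators hu hv hd hcu hcv
  have hwu : u * v * star u * star v ∈ unitary B :=
    mul_mem (mul_mem (mul_mem hu hv) (Unitary.star_mem hu)) (Unitary.star_mem hv)
  obtain ⟨ω, hω1, hω⟩ := eq_algebraMap_of_unique_trace hu hv hd hw hτ hwu hw
  have huv : u * v = ω • (v * u) := by
    rw [Algebra.smul_def, ← hω]
    simp only [mul_assoc]
    rw [← mul_assoc (star v) v, Unitary.star_mul_self_of_mem hv, one_mul,
      Unitary.star_mul_self_of_mem hu, mul_one]
  by_cases hfin : IsOfFinOrder ω
  · right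
    have hn : 0 < orderOf ω := hfin.orderOf_pos
    have hprim := IsPrimitiveRoot.orderOf ω
    -- Moving v past u^n costs ω^n = 1, so u^n is central; likewise v^n below.
    have hun : ∀ x, Commute (u ^ orderOf ω) x :=
      commute_of_generators hu hv hd (Commute.pow_self u _) (by
        have := pow_mul_eq_smul huv (orderOf ω)
        rwa [pow_orderOf_eq_one, one_smul] at this)
    have hvn : ∀ x, Commute (v ^ orderOf ω) x :=
      commute_of_generators hu hv hd (by
        have := mul_pow_eq_smul huv (orderOf ω)
        rw [pow_orderOf_eq_one, one_smul] at this
        exact this.symm) (Commute.pow_self v _)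
    obtain ⟨μ, hμ, hμu⟩ := eq_algebraMap_of_unique_trace hu hv hd hw hτ (pow_mem hu _) hun
    obtain ⟨ν, hν, hνv⟩ := eq_algebraMap_of_unique_trace hu hv hd hw hτ (pow_mem hv _) hvn
    obtain ⟨τ, hτ, -⟩ := hτ
    have : Nontrivial B := ⟨1, 0, fun h => by
      have := hτ.map_one
      rw [h, map_zero] at this
      exact zero_ne_one this⟩
    exact ⟨orderOf ω, hn, nonempty_starAlgEquiv_matrix hu hv hd hn hprim huv hμ hν hμu hνv⟩
  · left
    obtain ⟨τ, hτ, -⟩ := hτ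
    have hpi : (Real.pi : ℂ) ≠ 0 := Complex.ofReal_ne_zero.2 Real.pi_ne_zero
    have hexp : Complex.exp (2 * Real.pi * Complex.I * (ω.arg / (2 * Real.pi) : ℝ)) = ω := by
      have : 2 * Real.pi * Complex.I * (ω.arg / (2 * Real.pi) : ℝ) = ω.arg * Complex.I := by
        push_cast; field_simp
      rw [this]
      have := Complex.norm_mul_exp_arg_mul_I ω
      rwa [hω1, Complex.ofReal_one, one_mul] at this
    refine ⟨ω.arg / (2 * Real.pi), ?_, ?_⟩
    · rintro ⟨q, hq⟩
      -- If θ were a rational q, the denominator of q would be an exponent killing ω.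
      refine hfin (isOfFinOrder_iff_pow_eq_one.2 ⟨q.den, q.den_pos, ?_⟩)
      rw [← hexp, ← hq, ← Complex.exp_nat_mul, Complex.exp_eq_one_iff]
      refine ⟨q.num, ?_⟩
      have : (q.den : ℂ) * (q : ℂ) = q.num := by exact_mod_cast Rat.den_mul_eq_num q
      rw [← this]
      push_cast
      ring
    · refine nonempty_starAlgEquiv_rotationAlgebra hu hv hd hτ (by rw [hexp]; exact huv) ?_
      rw [hexp]
      exact fun k hk h => hfin (isOfFinOrder_iff_zpow_eq_one.2 ⟨k, hk, h⟩)

end Classification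

theorem corollary3p8 {A : Type*} [CStarAlgebra A] (u v : A)
    (hu : u ∈ unitary A) (hv : v ∈ unitary A)
    (huv : ‖u * v - v * u‖ < 2)
    (hcu : Commute (u * v * star u * star v) u)
    (hcv : Commute (u * v * star u * star v) v)
    (hτ : ∃! τ : generatedCStar u v →ₗ[ℂ] ℂ, IsTracialState τ) :
    (∃ θ : ℝ, Irrational θ ∧ Nonempty (generatedCStar u v ≃⋆ₐ[ℂ] RotationAlgebra θ)) ∨
    (∃ n : ℕ, 1 ≤ n ∧ Nonempty (generatedCStar u v ≃⋆ₐ[ℂ] Matrix (Fin n) (Fin n) ℂ)) := by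
  have hcl : IsClosed (generatedCStar u v : Set A) :=
    StarSubalgebra.isClosed_topologicalClosure _
  let S := generatedCStar u v
  have hle : StarAlgebra.adjoin ℂ {u, v} ≤ S := StarSubalgebra.le_topologicalClosure _
  let u' : S := ⟨u, hle (StarAlgebra.subset_adjoin ℂ _ (by simp))⟩
  let v' : S := ⟨v, hle (StarAlgebra.subset_adjoin ℂ _ (by simp))⟩
  have hu' : u' ∈ unitary S := ⟨Subtype.ext hu.1, Subtype.ext hu.2⟩
  have hv' : v' ∈ unitary S := ⟨Subtype.ext hv.1, Subtype.ext hv.2⟩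
  refine classification_of_unique_trace (B := S) hu' hv' ?_ (Subtype.ext hcu) (Subtype.ext hcv) hτ
  -- The inclusion carries the algebra generated inside S onto the one generated in A, and closure
  -- in the subspace S is computed in A; so u' and v' generate S topologically.
  have hmap : (StarAlgebra.adjoin ℂ {u', v'}).map S.subtype = StarAlgebra.adjoin ℂ {u, v} := by
    rw [StarAlgHom.map_adjoin, Set.image_pair]
    rfl
  rw [eq_top_iff]
  rintro ⟨x, hx⟩ -
  show (⟨x, hx⟩ : S) ∈ closure (StarAlgebra.adjoin ℂ {u', v'} : Set S)
  rw [closure_subtype]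
  have : (Subtype.val '' (StarAlgebra.adjoin ℂ {u', v'} : Set S))
      = (StarAlgebra.adjoin ℂ {u, v} : Set A) := by
    rw [← hmap]
    rfl
  show x ∈ closure (Subtype.val '' (StarAlgebra.adjoin ℂ {u', v'} : Set S))
  rw [this]
  exact hx

end
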